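/- Let $X=(X_t)_{t\ge 0}$ be a (non-killed) subordinator issued from $0$, i.e. a Lévy process with non-decreasing right-continuous paths, let $\mathbb P_x$ denote the law of $x+X$ (under which we again write $X$ for the process issued from $x$), and let $(\mathcal F_t)_{t\ge0}$ be its natural filtration. For a level $y$ put $\tau_y^+=\inf\{t\ge 0: X_t>y\}$. Assume that the potential measure $U(dz)=\int_0^\infty \mathbb P_0(X_t\in dz)\,dt$ has a continuous density $u\ge 0$ on $(0,\infty)$ with respect to Lebesgue measure. For $0\le x<y$ with $u(y-x)>0$, let $\mathbb P_x^{\circ,y}$ be the $h$-transform of $\mathbb P_x$ given, for each $t\ge0$, by $$\frac{d\mathbb P^{\circ,y}_x}{d\mathbb P_x}\Big|_{\mathcal F_t}=\frac{u(y-X_t)}{u(y-x)}\mathbf 1_{\{X_t\le y\}}$$ (a measure on events prior to the lifetime of the transformed process), so that for $b<y$, $t\ge 0$ and $A\in\mathcal F_t$ $$\mathbb P^{\circ,y}_x(A,\ t<\tau_b^+)=\mathbb E_x\Big[\mathbf 1_{A\cap\{t<\tau_b^+\}}\frac{u(y-X_t)}{u(y-x)}\Big].$$ Then for all $0\le x<b<y\le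 a$ with $u(y-x)>0$, the event $\{X_{\tau_y^+-}\ge y-\varepsilon\}$ (the level $y$ is passed at a finite time, and the position just before that time is at least $y-\varepsilon$) has positive $\mathbb P_x$-probability for every $\varepsilon>0$, and $$\mathbb P^{\circ,y}_x(A,\ t<\tau_b^+)=\lim_{\varepsilon\downarrow 0}\mathbb P_x\big(A,\ t<\tau_b^+\ \big|\ X_{\tau_y^+-}\ge y-\varepsilon\big),\qquad t\ge 0,\ A\in\mathcal F_t .$$ In this sense $\mathbb P_x^{\circ,y}$ is the law of $X$ conditioned to approach $y$ continuously. -/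

import Mathlib

open MeasureTheory ProbabilityTheory Filter Topology Set
open scoped NNReal ENNReal

/-- A (non-killed) subordinator issued from the origin: a Lévy process whose paths are almost surely
non-decreasing (and right-continuous; left limits then exist automatically). -/
structure IsSubordinator {Ω : Type*} [MeasurableSpace Ω] (P : Measure Ω) (X : ℝ≥0 → Ω → ℝ) :
    Prop where
  measurable : ∀ t, Measurable (X t)
  zero : ∀ᵐ ω ∂P, X 0 ω = 0
  indep_increments : HasIndepIncrements X P
  stationary_increments : ∀ s t, IdentDistrib (fun ω => X (s + t) ω - X s ω) (X t) P P
  paths : ∀ᵐ ω ∂P, Monotone (fun t => X t ω) ∧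
    ∀ t, ContinuousWithinAt (fun s => X s ω) (Ici t) t

/-- The process issued from `x`. The law `ℙ_x` is the law of `startedAt X x` under `P`. -/
def startedAt {Ω : Type*} (X : ℝ≥0 → Ω → ℝ) (x : ℝ) : ℝ≥0 → Ω → ℝ := fun t ω => x + X t ω

theorem IsSubordinator.stronglyMeasurable_startedAt {Ω : Type*} [MeasurableSpace Ω]
    {P : Measure Ω} {X : ℝ≥0 → Ω → ℝ} (hX : IsSubordinator P X) (x : ℝ) (t : ℝ≥0) :
    StronglyMeasurable (startedAt X x t) :=
  ((hX.measurable t).const_add x).stronglyMeasurable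

/-- The mass `U(B) = ∫₀^∞ P(X_t ∈ B) dt` which the potential measure gives to a Borel set `B`. -/
noncomputable def potentialMeasure {Ω : Type*} [MeasurableSpace Ω] (P : Measure Ω)
    (X : ℝ≥0 → Ω → ℝ) (B : Set ℝ) : ℝ≥0∞ :=
  ∫⁻ t in Ici (0 : ℝ), P {ω | X t.toNNReal ω ∈ B}

/-- `u` is a continuous density, on `(0, ∞)`, of the potential measure with respect to Lebesgue
measure. Nothing is required of the values of `u` outside `(0, ∞)`. -/
structure IsContinuousPotentialDensity {Ω : Type*} [MeasurableSpace Ω] (P : Measure Ω)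
    (X : ℝ≥0 → Ω → ℝ) (u : ℝ → ℝ) : Prop where
  continuousOn : ContinuousOn u (Ioi 0)
  nonneg : ∀ z, 0 < z → 0 ≤ u z
  density : ∀ B : Set ℝ, MeasurableSet B → B ⊆ Ioi 0 →
    potentialMeasure P X B = ∫⁻ z in B, ENNReal.ofReal (u z)

/-- The first passage time `τ_y⁺ = inf {t ≥ 0 : Y_t > y}`, equal to `⊤` if the level is never
passed. -/
noncomputable def passageTime {Ω : Type*} (Y : ℝ≥0 → Ω → ℝ) (y : ℝ) : Ω → WithTop ℝ≥0 :=
  hittingAfter Y (Ioi y) 0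

/-- The event `{t < τ_b⁺}`. -/
def beforePassage {Ω : Type*} (Y : ℝ≥0 → Ω → ℝ) (b : ℝ) (t : ℝ≥0) : Set Ω :=
  {ω | (t : WithTop ℝ≥0) < passageTime Y b ω}

/-- The event `{Y_{τ_y⁺-} ≥ z}`: the level `y` is passed at a finite time, and the left limit of the
path there is at least `z`. -/
def prePassageGE {Ω : Type*} (Y : ℝ≥0 → Ω → ℝ) (y z : ℝ) : Set Ω :=
  {ω | ∃ τ : ℝ≥0, passageTime Y y ω = τ ∧ z ≤ Function.leftLim (fun s => Y s ω) τ}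

/-- The `h`-transform `ℙ_x^{∘,y}` up to time `t`, where `Y` is the process issued from `x`: the
measure with density `u(y - Y_t) / u(y - x) 𝟙{Y_t ≤ y}` with respect to `P`. Its mass at `Λ` is
`ℙ_x^{∘,y}(Λ, t < ζ)` for the events `Λ` prior to `t`, where `ζ` is the lifetime of the transformed
process. Only paths with `Y_t < y` matter below, so that the value `u 0` plays no role. -/
noncomputable def hTransform {Ω : Type*} [MeasurableSpace Ω] (P : Measure Ω)
    (Y : ℝ≥0 → Ω → ℝ) (u : ℝ → ℝ) (x y : ℝ) (t : ℝ≥0) : Measure Ω :=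
  P.withDensity ({ω | Y t ω ≤ y}.indicator fun ω => ENNReal.ofReal (u (y - Y t ω) / u (y - x)))

/-!
The proof uses neither the Lévy measure nor the strong Markov property. Let `Y` be the process
issued from `x`, let `Λ` be an event prior to `t` on which `Y_t ≤ b`, let `ε < y - b`, and measure
the set of times `s ≥ t` with `Y_s ∈ [y - ε, y]` and `Y_{s+h} > y`. By the Markov property at the
fixed times `s` and `t` and by Fubini's theorem, the expected amount of such times on `Λ` is
`E[𝟙_Λ ∫₀^ε u(y - Y_t - r) P(X_h > r) dr]` (`IsSubordinator.lintegral_volume_passageWindow`,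
`lintegral_mul_crossingProb`). On the other hand, for a single path these times lie in the interval
of length `h` which ends at the passage time `τ_y⁺`. Divided by `h`, their amount is at most
`𝟙{Y_{τ_y⁺-} ≥ y - ε}` (`volume_passageWindow_le`), and its lower limit as `h → 0` is at least
`𝟙{Y_{τ_y⁺-} ≥ y - ε'}` for every `ε' < ε` (`one_le_liminf_volume_passageWindow`).

Since `u` is uniformly continuous on compact subsets of `(0, ∞)`, the expectation above is close to
`E[𝟙_Λ u(y - Y_t)]` times `∫₀^ε P(X_h > r) dr`, and the second factor depends neither on `Λ` nor on
`x` and `y`. With `S(ε) = sup_h h⁻¹ ∫₀^ε P(X_h > r) dr`, the supremum running over `h = 1/(n+1)`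
(`passageScale`), and the sublinearity of the integral in `ε`, this gives
`P(Λ, Y_{τ_y⁺-} ≥ y - ε) / S(ε) → E[𝟙_Λ u(y - Y_t)]` as `ε ↓ 0`. The case `t = 0` of the sure
event shows that `P(Y_{τ_y⁺-} ≥ y - ε) / S(ε) → u(y - x)`, and the quotient of the two limits is the claimed one.

The event `{t < τ_b⁺}` is not prior to `t`, but only prior to every `s > t`: for instance, when
`Y_t = b`, it depends on whether the path leaves `b` immediately. The bounds are therefore proved
for the events `A ∩ {Y_s ≤ b}` at the times `s > t`, and then `s ↓ t` at a fixed `ε`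
(`IsSubordinator.tendsto_measure_div_passageScale`).
-/

/-! ### Passage of a level along a single path -/

section Path

variable {Ω : Type*} {Y : ℝ≥0 → Ω → ℝ} {ω : Ω} {y : ℝ}

lemma passageTime_lt_iff {s : ℝ≥0} : passageTime Y y ω < s ↔ ∃ j < s, y < Y j ω := by
  refine (hittingAfter_lt_iff (u := Y) (s := Ioi y) (n := 0) (ω := ω)).trans ?_
  simp

lemma lt_of_passageTime_lt (hmono : Monotone fun s => Y s ω) {s : ℝ≥0}
    (h : passageTime Y y ω < s) : y < Y s ω := by
  obtain ⟨j, hj, hyj⟩ := passageTime_lt_iff.1 h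
  exact hyj.trans_le (hmono hj.le)

lemma le_of_lt_passageTime {s : ℝ≥0} (h : s < passageTime Y y ω) : Y s ω ≤ y :=
  not_lt.1 (notMem_of_lt_hittingAfter h zero_le)

lemma passageTime_le_of_lt {s : ℝ≥0} (h : y < Y s ω) : passageTime Y y ω ≤ s :=
  hittingAfter_le_of_mem zero_le h

/-- For a non-decreasing path, `{t < τ_b⁺}` is the event that the path is still at most `b` at some
time after `t`. -/
lemma mem_beforePassage_iff (hmono : Monotone fun s => Y s ω) {b : ℝ} {t : ℝ≥0} :
    ω ∈ beforePassage Y b t ↔ ∃ k : ℕ, Y (t + 1 / ((k : ℝ≥0) + 1)) ω ≤ b := by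
  have hpos : ∀ k : ℕ, (0 : ℝ≥0) < 1 / ((k : ℝ≥0) + 1) := fun k => by positivity
  constructor
  · intro h
    by_contra! hk
    have h' : (t : WithTop ℝ≥0) < passageTime Y b ω := h
    refine h'.not_ge (le_of_forall_gt fun c hc => ?_)
    induction c with
    | top => exact (passageTime_le_of_lt (hk 0)).trans_lt (WithTop.coe_lt_top _)
    | coe c =>
      have hc' : 0 < c - t := tsub_pos_of_lt (WithTop.coe_lt_coe.1 hc)
      obtain ⟨k, hk'⟩ := exists_nat_one_div_lt hc'
      exact passageTime_lt_iff.2 ⟨_, lt_tsub_iff_left.1 hk', hk k⟩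
  · rintro ⟨k, hk⟩
    refine lt_of_lt_of_le (WithTop.coe_lt_coe.2 (lt_add_of_pos_right t (hpos k)))
      (not_lt.1 fun h => ?_)
    exact absurd (lt_of_passageTime_lt hmono h) (not_lt.2 hk)

/-- The times `v` after `t` such that `Y_{t+v}` lies in `[y - ε, y]` and the level `y` is exceeded
within the next `h` units of time. -/
def passageWindow (Y : ℝ≥0 → Ω → ℝ) (y ε : ℝ) (t h : ℝ≥0) (ω : Ω) : Set ℝ :=
  {v | 0 ≤ v ∧ Y (t + v.toNNReal) ω ∈ Icc (y - ε) y ∧ y < Y (t + v.toNNReal + h) ω}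

lemma passageWindow_subset_Icc (hmono : Monotone fun s => Y s ω) {ε : ℝ} {t h τ : ℝ≥0}
    (hτ : passageTime Y y ω = τ) :
    passageWindow Y y ε t h ω ⊆ Icc ((τ : ℝ) - h - t) (τ - t) := by
  rintro v ⟨hv, hvI, hvh⟩
  have h1 : τ ≤ t + v.toNNReal + h := by
    exact_mod_cast hτ ▸ passageTime_le_of_lt hvh
  have h2 : t + v.toNNReal ≤ τ := by
    by_contra! hlt
    exact not_lt.2 hvI.2 (lt_of_passageTime_lt hmono (hτ ▸ WithTop.coe_lt_coe.2 hlt))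
  rw [← NNReal.coe_le_coe] at h1 h2
  push_cast [Real.coe_toNNReal _ hv] at h1 h2
  constructor <;> linarith

/-- The passage window lies in an interval of length `h` which ends at the passage over `y`, and it
is a null set when the position just before the passage is below `y - ε`. -/
lemma volume_passageWindow_le (hmono : Monotone fun s => Y s ω) {ε : ℝ} {t h : ℝ≥0} :
    volume (passageWindow Y y ε t h ω) ≤
      (prePassageGE Y y (y - ε)).indicator (fun _ => (h : ℝ≥0∞)) ω := by
  rcases (passageWindow Y y ε t h ω).eq_empty_or_nonempty with he | ⟨v₀, -, -, hv₀⟩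
  · simp [he]
  obtain ⟨τ, hτ⟩ : ∃ τ : ℝ≥0, passageTime Y y ω = τ :=
    ⟨_, (WithTop.coe_untop _
      ((passageTime_le_of_lt hv₀).trans_lt (WithTop.coe_lt_top _)).ne).symm⟩
  have hsub := passageWindow_subset_Icc (ε := ε) (t := t) (h := h) hmono hτ
  by_cases hp : ω ∈ prePassageGE Y y (y - ε)
  · rw [indicator_of_mem hp]
    refine (measure_mono hsub).trans ?_
    rw [Real.volume_Icc, show (τ : ℝ) - t - (τ - h - t) = h by ring, ENNReal.ofReal_coe_nnreal]
  -- Before `τ` the path is below its left limit at `τ`, so only the instant `τ` itself is left.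
  · have hlt : Function.leftLim (fun s => Y s ω) τ < y - ε := not_le.1 fun hle => hp ⟨τ, hτ, hle⟩
    have : passageWindow Y y ε t h ω ⊆ {(τ : ℝ) - t} := by
      intro v hv
      refine le_antisymm (hsub hv).2 (not_lt.1 fun hvτ => ?_)
      have h1 : t + v.toNNReal < τ := by
        rw [← NNReal.coe_lt_coe]
        push_cast [Real.coe_toNNReal _ hv.1]
        linarith
      have := hmono.le_leftLim h1
      linarith [hv.2.1.1]
    rw [indicator_of_notMem hp, measure_mono_null this Real.volume_singleton]

/-- A level above the current position is passed at a strictly later time. In particular the passage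
time is positive, so that the left limit of the path there is a genuine one. -/
lemma lt_of_passageTime_eq (hmono : Monotone fun s => Y s ω) {t τ : ℝ≥0}
    (hrc : ContinuousWithinAt (fun s => Y s ω) (Ici t) t) (ht : Y t ω < y)
    (hτ : passageTime Y y ω = τ) : t < τ := by
  have hev : ∀ᶠ s in 𝓝[≥] t, Y s ω < y := hrc.eventually (gt_mem_nhds ht)
  obtain ⟨s, hs, hts⟩ := ((hev.filter_mono (nhdsWithin_mono _ Ioi_subset_Ici_self)).and
    self_mem_nhdsWithin).exists
  refine lt_of_lt_of_le hts (not_lt.1 fun h => ?_)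
  exact absurd (lt_of_passageTime_lt hmono (hτ ▸ WithTop.coe_lt_coe.2 h)) (not_lt.2 hs.le)

/-- When the position before the passage over `y` is at least `y - ε`, all of the last `h` units of
time before the passage count for the window with parameter `ε' > ε`, once `h` is small. -/
lemma one_le_liminf_volume_passageWindow (hmono : Monotone fun s => Y s ω) {ε ε' : ℝ} {t : ℝ≥0}
    (hε : ε < ε') (hrc : ContinuousWithinAt (fun s => Y s ω) (Ici t) t) (ht : Y t ω < y)
    (hp : ω ∈ prePassageGE Y y (y - ε)) :
    1 ≤ liminf (fun n : ℕ => ((n : ℝ≥0∞) + 1) *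
      volume (passageWindow Y y ε' t (1 / ((n : ℝ≥0) + 1)) ω)) atTop := by
  obtain ⟨τ, hτ, hL⟩ := hp
  have htτ : t < τ := lt_of_passageTime_eq hmono hrc ht hτ
  have hne : (𝓝[<] τ).NeBot := nhdsLT_neBot_of_exists_lt ⟨t, htτ⟩
  obtain ⟨s₀, hs₀, hs₀τ⟩ : ∃ s₀, y - ε' < Y s₀ ω ∧ s₀ < τ :=
    (((hmono.tendsto_leftLim τ).eventually (lt_mem_nhds (by linarith : y - ε' < _))).and
      self_mem_nhdsWithin).exists
  set s₁ := max t s₀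
  have hs₁ : s₁ < τ := max_lt htτ hs₀τ
  have hev : ∀ᶠ n : ℕ in atTop, 1 / ((n : ℝ) + 1) < τ - s₁ :=
    (tendsto_one_div_add_atTop_nhds_zero_nat (𝕜 := ℝ)).eventually
      (gt_mem_nhds (sub_pos.2 (NNReal.coe_lt_coe.2 hs₁)))
  refine le_liminf_of_le (by isBoundedDefault) ?_
  filter_upwards [hev] with n hn
  have hts₁ : (t : ℝ) ≤ s₁ := NNReal.coe_le_coe.2 (le_max_left _ _)
  have hsub : Ioo ((τ : ℝ) - 1 / ((n : ℝ) + 1) - t) (τ - t) ⊆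
      passageWindow Y y ε' t (1 / ((n : ℝ≥0) + 1)) ω := by
    rintro v ⟨hv1, hv2⟩
    have hv : 0 ≤ v := by linarith
    have h1 : s₁ < t + v.toNNReal := by
      rw [← NNReal.coe_lt_coe]
      push_cast [Real.coe_toNNReal _ hv]
      linarith
    have h2 : t + v.toNNReal < τ := by
      rw [← NNReal.coe_lt_coe]
      push_cast [Real.coe_toNNReal _ hv]
      linarith
    have h3 : τ < t + v.toNNReal + 1 / ((n : ℝ≥0) + 1) := by
      rw [← NNReal.coe_lt_coe]
      push_cast [Real.coe_toNNReal _ hv]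
      linarith
    refine ⟨hv, ⟨?_, ?_⟩, ?_⟩
    · exact (hs₀.trans_le (hmono ((le_max_right t s₀).trans h1.le))).le
    · exact le_of_lt_passageTime (hτ ▸ WithTop.coe_lt_coe.2 h2)
    · exact lt_of_passageTime_lt hmono (hτ ▸ WithTop.coe_lt_coe.2 h3)
  calc (1 : ℝ≥0∞) = ((n : ℝ≥0∞) + 1) * ENNReal.ofReal (1 / ((n : ℝ) + 1)) := by
        rw [one_div, ENNReal.ofReal_inv_of_pos (by positivity),
          ENNReal.ofReal_add (by positivity) zero_le_one, ENNReal.ofReal_natCast,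
          ENNReal.ofReal_one, ENNReal.mul_inv_cancel (by simp) (by simp)]
    _ ≤ _ := by
        gcongr
        refine le_trans (le_of_eq ?_) (measure_mono hsub)
        rw [Real.volume_Ioo]
        congr 1
        ring

end Path

section Subordinator

variable {Ω : Type*} [MeasurableSpace Ω] {P : Measure Ω} {X : ℝ≥0 → Ω → ℝ}

/-! ### The simple Markov property -/

/-- Along a monotone sequence of times, the process up to the `N`-th time is independent of the next
increment. -/
lemma ProbabilityTheory.HasIndepIncrements.indepFun_sub_next
    (hind : HasIndepIncrements X P) (hm : ∀ t, Measurable (X t)) {τ : ℕ → ℝ≥0} (hτ : Monotone τ)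
    (N : ℕ) :
    IndepFun (fun ω (i : Iic N) => X (τ i) ω - X (τ 0) ω)
      (fun ω => X (τ (N + 1)) ω - X (τ N) ω) P := by
  have h := (hind.nat hτ).indepFun_finset (Finset.range N) {N} (by simp)
    (fun i => (hm _).sub (hm _))
  have hψ : Measurable fun d : ({N} : Finset ℕ) → ℝ => d ⟨N, by simp⟩ := measurable_pi_apply _
  have h' := h.comp
    (φ := fun (d : Finset.range N → ℝ) (i : Iic N) =>
      ∑ k ∈ Finset.range (i : ℕ), if hk : k ∈ Finset.range N then d ⟨k, hk⟩ else 0)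
    (measurable_pi_lambda _ fun i => Finset.measurable_fun_sum _ fun k _ => by
      by_cases hk : k ∈ Finset.range N
      · simp only [hk, dif_pos]
        fun_prop
      · simp only [hk, dif_neg, not_false_eq_true, measurable_const])
    hψ
  convert h' using 1
  · ext ω i
    have hi : (i : ℕ) ≤ N := i.2
    simp only [Function.comp_apply]
    rw [← Finset.sum_range_sub (fun k => X (τ k) ω)]
    refine Finset.sum_congr rfl fun k hk => ?_
    rw [dif_pos (Finset.mem_range.2 ((Finset.mem_range.1 hk).trans_le hi))]
  · rfl

/-- Every finite set of times up to `t` lies on a monotone sequence of times which starts at `0` and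
has `t` and `t + v` as consecutive members. -/
lemma exists_monotone_seq_through (t v : ℝ≥0) (I : Finset (Iic t)) :
    ∃ (τ : ℕ → ℝ≥0) (N : ℕ), Monotone τ ∧ τ 0 = 0 ∧ τ N = t ∧ τ (N + 1) = t + v ∧
      ∀ i ∈ I, ∃ k ≤ N, τ k = i := by
  classical
  set J : Finset ℝ≥0 := insert 0 (insert t (I.image Subtype.val)) with hJ
  have hJt : ∀ j ∈ J, j ≤ t := by
    intro j hj
    simp only [hJ, Finset.mem_insert, Finset.mem_image] at hj
    rcases hj with rfl | rfl | ⟨i, -, rfl⟩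
    · exact zero_le
    · exact le_rfl
    · exact i.2
  have hne : J.Nonempty := ⟨0, by simp [hJ]⟩
  have hcard : 0 < J.card := hne.card_pos
  set e := J.orderEmbOfFin rfl with he
  have he_mem : ∀ k, e k ∈ J := fun k => J.orderEmbOfFin_mem rfl k
  refine ⟨fun k => if h : k < J.card then e ⟨k, h⟩ else t + v, J.card - 1, ?_, ?_, ?_, ?_, ?_⟩
  · intro k l hkl
    dsimp only
    split_ifs with h1 h2
    · exact e.monotone hkl
    · exact (hJt _ (he_mem _)).trans le_self_add
    · omega
    · exact le_rfl
  · simp only [hcard, dif_pos]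
    rw [he, Finset.orderEmbOfFin_zero rfl hcard]
    exact le_antisymm (Finset.min'_le _ _ (by simp [hJ])) zero_le
  · have : J.card - 1 < J.card := by omega
    simp only [this, dif_pos]
    rw [he, Finset.orderEmbOfFin_last rfl hcard]
    exact le_antisymm (hJt _ (Finset.max'_mem _ _)) (Finset.le_max' _ _ (by simp [hJ]))
  · exact dif_neg (by omega)
  · intro i hi
    have hiJ : (i : ℝ≥0) ∈ (J : Set ℝ≥0) := by
      simp only [hJ, Finset.coe_insert, Finset.coe_image, mem_insert_iff, mem_image]
      exact Or.inr (Or.inr ⟨i, hi, rfl⟩)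
    rw [← Finset.range_orderEmbOfFin J rfl] at hiJ
    obtain ⟨k, hk⟩ := hiJ
    refine ⟨k, by have := k.2; omega, ?_⟩
    exact (dif_pos k.2).trans hk

namespace IsSubordinator

/-- The past up to time `t` is independent of the increment after `t`. -/
lemma indep_natural [IsProbabilityMeasure P] (hX : IsSubordinator P X) (x : ℝ) (t v : ℝ≥0) :
    Indep (Filtration.natural (startedAt X x) (hX.stronglyMeasurable_startedAt x) t)
      (MeasurableSpace.comap (fun ω => X (t + v) ω - X t ω) inferInstance) P := by
  rw [Filtration.natural_eq_comap]
  have key : IndepFun (fun ω (j : Iic t) => startedAt X x j ω)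
      (fun ω => X (t + v) ω - X t ω) P := by
    refine IndepFun.process_indepFun (X := fun j : Iic t => startedAt X x j)
      (fun j => (hX.measurable _).const_add x) ((hX.measurable _).sub (hX.measurable _))
      fun I => ?_
    obtain ⟨τ, N, hτ, hτ0, hτN, hτN', hI⟩ := exists_monotone_seq_through t v I
    choose! k hkN hk using hI
    have h := hX.indep_increments.indepFun_sub_next hX.measurable hτ N
    have h' := h.comp
      (φ := fun (d : Iic N → ℝ) (i : I) => x + d ⟨k i, hkN i i.2⟩) (ψ := id)
      (by fun_prop) measurable_id
    refine h'.congr ?_ ?_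
    · filter_upwards [hX.zero] with ω hω
      ext i
      simp [startedAt, hτ0, hω, hk i i.2]
    · simp [hτN, hτN']
  exact key

/-- The simple Markov property at time `t`. -/
lemma setLIntegral_markov [IsProbabilityMeasure P] (hX : IsSubordinator P X) (x : ℝ) (t v : ℝ≥0)
    {Λ : Set Ω}
    (hΛ : MeasurableSet[Filtration.natural (startedAt X x) (hX.stronglyMeasurable_startedAt x) t] Λ)
    {g : ℝ × ℝ → ℝ≥0∞} (hg : Measurable g) :
    ∫⁻ ω in Λ, g (startedAt X x t ω, X (t + v) ω - X t ω) ∂P =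
      ∫⁻ ω in Λ, ∫⁻ ω', g (startedAt X x t ω, X v ω') ∂P ∂P := by
  set F := Filtration.natural (startedAt X x) (hX.stronglyMeasurable_startedAt x) with hF
  have hΛ' : MeasurableSet Λ := F.le t _ hΛ
  set W : Ω → ℝ≥0∞ × ℝ := fun ω => (Λ.indicator 1 ω, startedAt X x t ω) with hW
  have hWF : Measurable[F t] W :=
    @Measurable.prodMk _ (F t) _ _ _ _ _ _ (measurable_const.indicator hΛ)
      (Filtration.stronglyAdapted_natural (hX.stronglyMeasurable_startedAt x) t).measurable
  have hWm : Measurable W := hWF.mono (F.le t) le_rfl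
  have hVm : Measurable fun ω => X (t + v) ω - X t ω := (hX.measurable _).sub (hX.measurable _)
  have hind : IndepFun W (fun ω => X (t + v) ω - X t ω) P :=
    indep_of_indep_of_le_left (hX.indep_natural x t v) hWF.comap_le
  have hmap := (indepFun_iff_map_prod_eq_prod_map_map hWm.aemeasurable hVm.aemeasurable).1 hind
  set G : (ℝ≥0∞ × ℝ) × ℝ → ℝ≥0∞ := fun p => p.1.1 * g (p.1.2, p.2) with hG
  have hGm : Measurable G := by fun_prop
  have hXv : Measurable (X v) := hX.measurable v
  calc ∫⁻ ω in Λ, g (startedAt X x t ω, X (t + v) ω - X t ω) ∂P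
      = ∫⁻ ω, G (W ω, X (t + v) ω - X t ω) ∂P := by
        rw [← lintegral_indicator hΛ']
        refine lintegral_congr fun ω => ?_
        by_cases h : ω ∈ Λ <;> simp [hG, hW, h]
    _ = ∫⁻ p, G p ∂((P.map W).prod (P.map fun ω => X (t + v) ω - X t ω)) := by
        rw [← hmap, lintegral_map hGm (hWm.prodMk hVm)]
    _ = ∫⁻ p, G p ∂((P.map W).prod (P.map (X v))) := by
        rw [(hX.stationary_increments t v).map_eq]
    _ = ∫⁻ ω, ∫⁻ ω', G (W ω, X v ω') ∂P ∂P := by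
        rw [lintegral_prod _ hGm.aemeasurable, lintegral_map hGm.lintegral_prod_right' hWm]
        refine lintegral_congr fun ω => ?_
        rw [lintegral_map (by fun_prop) hXv]
    _ = ∫⁻ ω in Λ, ∫⁻ ω', g (startedAt X x t ω, X v ω') ∂P ∂P := by
        rw [← lintegral_indicator hΛ']
        refine lintegral_congr fun ω => ?_
        by_cases h : ω ∈ Λ <;> simp [hG, hW, h]

/-! ### Joint measurability -/

/-- A subordinator has a jointly measurable version, equal to it at all times on an event of full
probability. -/
lemma exists_measurable_version (hX : IsSubordinator P X) :
    ∃ Z : ℝ≥0 → Ω → ℝ, Measurable (Function.uncurry Z) ∧ ∀ᵐ ω ∂P, ∀ t, Z t ω = X t ω := by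
  obtain ⟨S, hSsub, hS, hPS⟩ := exists_measurable_superset_of_null (ae_iff.1 hX.paths)
  -- On `Sᶜ` all paths are right-continuous: discretise time from the right.
  let r : ℕ → ℝ≥0 → ℝ≥0 := fun n t => ((⌊t * (n + 1)⌋₊ : ℝ≥0) + 1) / (n + 1)
  refine ⟨fun t ω => Sᶜ.indicator (X t) ω, ?_, ?_⟩
  · refine measurable_of_tendsto_metrizable
      (f := fun n (p : ℝ≥0 × Ω) => Sᶜ.indicator (X (r n p.1)) p.2) (fun n => ?_)
      (tendsto_pi_nhds.2 ?_)
    · have h1 : Measurable fun q : ℕ × Ω =>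
          Sᶜ.indicator (X (((q.1 : ℝ≥0) + 1) / (n + 1))) q.2 :=
        measurable_from_prod_countable_right fun m =>
          (hX.measurable ((m + 1) / (n + 1))).indicator hS.compl
      have h2 : Measurable fun p : ℝ≥0 × Ω => ((⌊p.1 * (n + 1)⌋₊ : ℕ), p.2) :=
        (Nat.measurable_floor.comp (measurable_fst.mul_const _)).prodMk measurable_snd
      exact h1.comp h2
    · rintro ⟨t, ω⟩
      by_cases hω : ω ∈ S
      · simp [hω, Function.uncurry]
      have hgood : ContinuousWithinAt (fun s => X s ω) (Ici t) t := by
        by_contra h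
        exact hω (hSsub fun h' => h (h'.2 t))
      have hr : Tendsto (fun n => r n t) atTop (𝓝[≥] t) := by
        have hpos : ∀ n : ℕ, (0 : ℝ≥0) < n + 1 := fun n => by positivity
        have hlow : ∀ n, t ≤ r n t := fun n => by
          rw [le_div_iff₀ (hpos n)]
          exact (Nat.lt_floor_add_one _).le
        have hup : ∀ n, r n t ≤ t + 1 / ((n : ℝ≥0) + 1) := fun n => by
          rw [div_le_iff₀ (hpos n), add_mul, one_div, inv_mul_cancel₀ (hpos n).ne']
          gcongr
          exact Nat.floor_le zero_le
        refine tendsto_nhdsWithin_iff.2 ⟨?_, Eventually.of_forall hlow⟩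
        refine tendsto_of_tendsto_of_tendsto_of_le_of_le tendsto_const_nhds ?_ hlow hup
        simpa using tendsto_const_nhds.add (tendsto_one_div_add_atTop_nhds_zero_nat (𝕜 := ℝ≥0))
      have := hgood.tendsto.comp hr
      simpa [hω, Function.uncurry, Function.comp_def] using this
  · have : ∀ᵐ ω ∂P, ω ∉ S := measure_eq_zero_iff_ae_notMem.1 hPS
    filter_upwards [this] with ω hω t
    simp [hω]

end IsSubordinator

/-! ### The time spent close below a level -/

/-- The probability that an increment over a time `h` leads from a position `w ∈ [y - ε, y]` to
above `y`; it is `0` at the other positions `w`. -/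
noncomputable def crossingProb (P : Measure Ω) (X : ℝ≥0 → Ω → ℝ) (y ε : ℝ) (h : ℝ≥0) : ℝ → ℝ≥0∞ :=
  (Icc (y - ε) y).indicator fun w => P {ω | y - w < X h ω}

lemma antitone_tail (s : ℝ≥0) : Antitone fun r : ℝ => P {ω | r < X s ω} :=
  fun _ _ hrr' => measure_mono fun _ hω => lt_of_le_of_lt hrr' hω

lemma measurable_crossingProb (y ε : ℝ) (h : ℝ≥0) : Measurable (crossingProb P X y ε h) :=
  ((antitone_tail h).measurable.comp (measurable_const.sub measurable_id)).indicator
    measurableSet_Icc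

namespace IsSubordinator

/-- Integration against the potential measure of functions which vanish outside `(0, ∞)`. -/
lemma lintegral_potential [IsProbabilityMeasure P] (hX : IsSubordinator P X) {u : ℝ → ℝ}
    (hu : IsContinuousPotentialDensity P X u) {f : ℝ → ℝ≥0∞} (hf : Measurable f)
    (hf0 : ∀ z ≤ 0, f z = 0) :
    ∫⁻ v in Ici (0 : ℝ), ∫⁻ ω, f (X v.toNNReal ω) ∂P =
      ∫⁻ z in Ioi 0, ENNReal.ofReal (u z) * f z := by
  obtain ⟨Z, hZ, hZX⟩ := hX.exists_measurable_version
  have hZ' : Measurable fun p : ℝ × Ω => Z p.1.toNNReal p.2 :=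
    hZ.comp ((measurable_real_toNNReal.comp measurable_fst).prodMk measurable_snd)
  set U : Measure ℝ :=
    ((volume.restrict (Ici (0 : ℝ))).prod P).map fun p => Z p.1.toNNReal p.2 with hU
  have hlin : ∀ g : ℝ → ℝ≥0∞, Measurable g →
      ∫⁻ z, g z ∂U = ∫⁻ v in Ici (0 : ℝ), ∫⁻ ω, g (X v.toNNReal ω) ∂P := by
    intro g hg
    rw [hU, lintegral_map hg hZ',
      lintegral_prod (fun p : ℝ × Ω => g (Z p.1.toNNReal p.2)) (hg.comp hZ').aemeasurable]
    refine lintegral_congr fun v => lintegral_congr_ae ?_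
    filter_upwards [hZX] with ω hω
    rw [hω]
  have hUd : U.restrict (Ioi 0) =
      (volume.restrict (Ioi 0)).withDensity fun z => ENNReal.ofReal (u z) := by
    refine Measure.ext fun B hB => ?_
    rw [Measure.restrict_apply hB, withDensity_apply _ hB, Measure.restrict_restrict hB,
      ← hu.density _ (hB.inter measurableSet_Ioi) inter_subset_right, potentialMeasure,
      ← lintegral_indicator_one (hB.inter measurableSet_Ioi),
      hlin _ (measurable_one.indicator (hB.inter measurableSet_Ioi))]
    refine lintegral_congr fun v => ?_
    exact lintegral_indicator_one (hX.measurable _ (hB.inter measurableSet_Ioi))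
  rw [← hlin f hf]
  calc ∫⁻ z, f z ∂U = ∫⁻ z in Ioi 0, f z ∂U := by
        rw [← lintegral_indicator measurableSet_Ioi]
        refine lintegral_congr fun z => ?_
        by_cases hz : 0 < z
        · simp [hz]
        · simp [hz, hf0 z (not_lt.1 hz)]
    _ = ∫⁻ z in Ioi 0, ENNReal.ofReal (u z) * f z := by
        rw [hUd, lintegral_withDensity_eq_lintegral_mul₀
          (hu.continuousOn.aemeasurable measurableSet_Ioi).ennreal_ofReal hf.aemeasurable]
        rfl

/-- Measurability of the time spent in the passage window, and Fubini's theorem for it. -/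
lemma aemeasurable_volume_passageWindow [SFinite P] (hX : IsSubordinator P X) (x y ε : ℝ)
    (t h : ℝ≥0) :
    AEMeasurable (fun ω => volume (passageWindow (startedAt X x) y ε t h ω)) P ∧
    ∀ Λ, MeasurableSet Λ → ∫⁻ ω in Λ, volume (passageWindow (startedAt X x) y ε t h ω) ∂P =
      ∫⁻ v in Ici (0 : ℝ), P (Λ ∩ ({ω | startedAt X x (t + v.toNNReal) ω ∈ Icc (y - ε) y} ∩
        {ω | y < startedAt X x (t + v.toNNReal + h) ω})) := by
  obtain ⟨Z, hZ, hZX⟩ := hX.exists_measurable_version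
  have hZ1 : Measurable fun p : ℝ × Ω => x + Z (t + p.1.toNNReal) p.2 :=
    (hZ.comp ((measurable_const.add (measurable_real_toNNReal.comp measurable_fst)).prodMk
      measurable_snd)).const_add x
  have hZ2 : Measurable fun p : ℝ × Ω => x + Z (t + p.1.toNNReal + h) p.2 :=
    (hZ.comp (((measurable_const.add
      (measurable_real_toNNReal.comp measurable_fst)).add_const h).prodMk
      measurable_snd)).const_add x
  set S : Set (ℝ × Ω) := {p | 0 ≤ p.1 ∧ x + Z (t + p.1.toNNReal) p.2 ∈ Icc (y - ε) y ∧
    y < x + Z (t + p.1.toNNReal + h) p.2} with hS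
  have hSm : MeasurableSet S :=
    (measurableSet_le measurable_const measurable_fst).inter
      ((hZ1 measurableSet_Icc).inter (measurableSet_lt measurable_const hZ2))
  have hae : (fun ω => volume (passageWindow (startedAt X x) y ε t h ω)) =ᵐ[P]
      fun ω => volume ((fun v => (v, ω)) ⁻¹' S) := by
    filter_upwards [hZX] with ω hω
    congr 1
    ext v
    simp [passageWindow, startedAt, hS, hω]
  refine ⟨⟨_, measurable_measure_prodMk_right hSm, hae⟩, fun Λ hΛ => ?_⟩
  rw [lintegral_congr_ae (ae_restrict_of_ae hae), ← Measure.prod_apply_symm hSm,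
    Measure.prod_apply hSm, ← lintegral_indicator measurableSet_Ici]
  refine lintegral_congr fun v => ?_
  by_cases hv : 0 ≤ v
  · rw [indicator_of_mem (mem_Ici.2 hv), Measure.restrict_apply (measurable_prodMk_left hSm),
      inter_comm]
    refine measure_congr (Filter.eventuallyEq_set.2 ?_)
    filter_upwards [hZX] with ω hω
    simp [hS, startedAt, hω, hv]
  · have : (Prod.mk v ⁻¹' S : Set Ω) = ∅ := by ext ω; simp [hS, hv]
    rw [this, measure_empty, indicator_of_notMem (by simpa using hv)]

/-- The expected time spent in the passage window after `t`: the Markov property at the time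
`t + v` gives the factor `crossingProb`, and the one at time `t` brings in the potential density. -/
lemma lintegral_volume_passageWindow [IsProbabilityMeasure P] (hX : IsSubordinator P X)
    {u : ℝ → ℝ} (hu : IsContinuousPotentialDensity P X u) {x b y ε : ℝ} (hε : ε < y - b)
    (t h : ℝ≥0) {Λ : Set Ω}
    (hΛ : MeasurableSet[Filtration.natural (startedAt X x) (hX.stronglyMeasurable_startedAt x) t] Λ)
    (hΛb : ∀ ω ∈ Λ, startedAt X x t ω ≤ b) :
    ∫⁻ ω in Λ, volume (passageWindow (startedAt X x) y ε t h ω) ∂P =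
      ∫⁻ ω in Λ, (∫⁻ z in Ioi (0 : ℝ), ENNReal.ofReal (u z) *
        crossingProb P X y ε h (startedAt X x t ω + z)) ∂P := by
  set F := Filtration.natural (startedAt X x) (hX.stronglyMeasurable_startedAt x) with hF
  have hΛ' : MeasurableSet Λ := F.le t _ hΛ
  have hk := measurable_crossingProb (P := P) (X := X) y ε h
  have hYm : ∀ s, Measurable (startedAt X x s) := fun s => (hX.measurable s).const_add x
  obtain ⟨Z, hZ, hZX⟩ := hX.exists_measurable_version
  rw [(hX.aemeasurable_volume_passageWindow x y ε t h).2 Λ hΛ']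
  have hstep : ∀ v : ℝ≥0, P (Λ ∩ ({ω | startedAt X x (t + v) ω ∈ Icc (y - ε) y} ∩
      {ω | y < startedAt X x (t + v + h) ω})) =
      ∫⁻ ω in Λ, ∫⁻ ω', crossingProb P X y ε h (startedAt X x t ω + Z v ω') ∂P ∂P := by
    intro v
    set E : Set Ω := {ω | startedAt X x (t + v) ω ∈ Icc (y - ε) y} with hE
    have hEF : MeasurableSet[F (t + v)] E :=
      (Filtration.stronglyAdapted_natural
        (hX.stronglyMeasurable_startedAt x) (t + v)).measurable measurableSet_Icc
    have hE' : MeasurableSet E := F.le _ _ hEF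
    set g : ℝ × ℝ → ℝ≥0∞ := {p : ℝ × ℝ | y < p.1 + p.2}.indicator 1 with hg
    have hgm : Measurable g := measurable_one.indicator
      (measurableSet_lt measurable_const (measurable_fst.add measurable_snd))
    have hUm : MeasurableSet {ω | y < startedAt X x (t + v + h) ω} :=
      measurableSet_lt measurable_const (hYm _)
    calc P (Λ ∩ (E ∩ {ω | y < startedAt X x (t + v + h) ω}))
        = ∫⁻ ω in Λ ∩ E, g (startedAt X x (t + v) ω, X (t + v + h) ω - X (t + v) ω) ∂P := by
          rw [← inter_assoc, inter_comm, ← Measure.restrict_apply hUm,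
            ← lintegral_indicator_one hUm]
          refine lintegral_congr fun ω => ?_
          simp only [hg, startedAt, indicator_apply, mem_ofPred_eq]
          congr 2
          ring
      _ = ∫⁻ ω in Λ ∩ E, ∫⁻ ω', g (startedAt X x (t + v) ω, X h ω') ∂P ∂P :=
          hX.setLIntegral_markov x (t + v) h
            ((F.mono (le_add_of_nonneg_right zero_le) _ hΛ).inter hEF) hgm
      _ = ∫⁻ ω in Λ, crossingProb P X y ε h (startedAt X x (t + v) ω) ∂P := by
          rw [← lintegral_indicator (hΛ'.inter hE'), ← lintegral_indicator hΛ']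
          refine lintegral_congr fun ω => ?_
          by_cases h1 : ω ∈ Λ
          · by_cases h2 : ω ∈ E
            · rw [indicator_of_mem (mem_inter h1 h2), indicator_of_mem h1, crossingProb,
                indicator_of_mem (show startedAt X x (t + v) ω ∈ Icc (y - ε) y from h2),
                ← lintegral_indicator_one (measurableSet_lt measurable_const (hX.measurable h))]
              refine lintegral_congr fun ω' => ?_
              simp only [hg, indicator_apply, mem_ofPred_eq, sub_lt_iff_lt_add']
              rfl
            · rw [indicator_of_notMem (fun h => h2 h.2), indicator_of_mem h1, crossingProb,
                indicator_of_notMem (show startedAt X x (t + v) ω ∉ Icc (y - ε) y from h2)]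
          · rw [indicator_of_notMem (fun h => h1 h.1), indicator_of_notMem h1]
      _ = ∫⁻ ω in Λ, crossingProb P X y ε h
            (startedAt X x t ω + (X (t + v) ω - X t ω)) ∂P := by
          refine lintegral_congr fun ω => ?_
          rw [startedAt, startedAt, add_assoc, add_sub_cancel]
      _ = ∫⁻ ω in Λ, ∫⁻ ω', crossingProb P X y ε h (startedAt X x t ω + X v ω') ∂P ∂P :=
          hX.setLIntegral_markov x t v hΛ
            (hk.comp (measurable_fst.add measurable_snd))
      _ = _ := by
          refine lintegral_congr fun ω => lintegral_congr_ae ?_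
          filter_upwards [hZX] with ω' hω'
          rw [hω']
  simp_rw [hstep]
  have hjoint : Measurable fun q : (ℝ × Ω) × Ω =>
      crossingProb P X y ε h (startedAt X x t q.1.2 + Z q.1.1.toNNReal q.2) :=
    hk.comp (((hYm t).comp (measurable_snd.comp measurable_fst)).add
      (hZ.comp ((measurable_real_toNNReal.comp (measurable_fst.comp measurable_fst)).prodMk
        measurable_snd)))
  rw [lintegral_lintegral_swap hjoint.lintegral_prod_right'.aemeasurable]
  refine setLIntegral_congr_fun hΛ' fun ω hω => ?_
  have hf : Measurable fun z => crossingProb P X y ε h (startedAt X x t ω + z) :=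
    hk.comp (measurable_const.add measurable_id)
  rw [← hX.lintegral_potential hu hf]
  · refine lintegral_congr fun v => lintegral_congr_ae ?_
    filter_upwards [hZX] with ω' hω'
    rw [hω']
  · intro z hz
    have := hΛb ω hω
    exact indicator_of_notMem (fun h => by linarith [h.1]) _

end IsSubordinator

/-! ### The normalising function -/

/-- The truncated mean `E[min (X_h, ε)]` of a non-negative `X_h`, written as `∫₀^ε P(X_h > s) ds`.
-/
noncomputable def truncatedMean (P : Measure Ω) (X : ℝ≥0 → Ω → ℝ) (h : ℝ≥0) (ε : ℝ) : ℝ≥0∞ :=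
  ∫⁻ s in Icc 0 ε, P {ω | s < X h ω}

/-- The supremum over `h = 1, 1/2, 1/3, …` of `E[min (X_h, ε)] / h`. It is comparable to the
probability of passing a level from within distance `ε`. -/
noncomputable def passageScale (P : Measure Ω) (X : ℝ≥0 → Ω → ℝ) (ε : ℝ) : ℝ≥0∞ :=
  ⨆ n : ℕ, ((n : ℝ≥0∞) + 1) * truncatedMean P X (1 / ((n : ℝ≥0) + 1)) ε

lemma truncatedMean_ne_top [IsProbabilityMeasure P] (h : ℝ≥0) (ε : ℝ) :
    truncatedMean P X h ε ≠ ⊤ := by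
  refine ne_of_lt (lt_of_le_of_lt (lintegral_mono fun _ => prob_le_one) ?_)
  simp

/-- Sublinearity in `ε`, a consequence of the concavity of `truncatedMean`. -/
lemma truncatedMean_mul_le (h : ℝ≥0) {ε κ : ℝ} (hε : 0 ≤ ε) (hκ : 0 ≤ κ) :
    truncatedMean P X h ((1 + κ) * ε) ≤ (1 + ENNReal.ofReal κ) * truncatedMean P X h ε := by
  set φ : ℝ → ℝ≥0∞ := fun s => P {ω | s < X h ω} with hφ
  have hanti : Antitone φ := antitone_tail h
  have h1 : ∫⁻ s in Ioc ε ((1 + κ) * ε), φ s ≤ φ ε * ENNReal.ofReal (κ * ε) := by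
    refine (setLIntegral_mono measurable_const fun s hs => hanti hs.1.le).trans (le_of_eq ?_)
    rw [setLIntegral_const, Real.volume_Ioc]
    congr 2
    ring
  have h2 : φ ε * ENNReal.ofReal ε ≤ truncatedMean P X h ε := by
    refine le_trans (le_of_eq ?_)
      (setLIntegral_mono (f := fun _ => φ ε) hanti.measurable fun s hs => hanti hs.2)
    rw [setLIntegral_const, Real.volume_Icc, sub_zero]
  have hκε : ε ≤ (1 + κ) * ε := by nlinarith
  calc truncatedMean P X h ((1 + κ) * ε)
      = ∫⁻ s in Icc 0 ε ∪ Ioc ε ((1 + κ) * ε), φ s := by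
        rw [truncatedMean, Icc_union_Ioc_eq_Icc hε hκε]
    _ ≤ truncatedMean P X h ε + φ ε * ENNReal.ofReal (κ * ε) :=
        (lintegral_union_le _ _ _).trans (add_le_add le_rfl h1)
    _ = truncatedMean P X h ε + ENNReal.ofReal κ * (φ ε * ENNReal.ofReal ε) := by
        rw [ENNReal.ofReal_mul hκ]; ring
    _ ≤ truncatedMean P X h ε + ENNReal.ofReal κ * truncatedMean P X h ε := by gcongr
    _ = _ := by ring

/-- The change of variables `z = y - w - s`, from the size `z` of the increment to the distance `s`
left to the level `y`. -/
lemma lintegral_mul_crossingProb (u : ℝ → ℝ) {w y ε : ℝ} (hε : ε < y - w) (h : ℝ≥0) :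
    ∫⁻ z in Ioi (0 : ℝ), ENNReal.ofReal (u z) * crossingProb P X y ε h (w + z) =
      ∫⁻ s in Icc 0 ε, ENNReal.ofReal (u (y - w - s)) * P {ω | s < X h ω} := by
  rw [← lintegral_indicator measurableSet_Ioi, ← lintegral_indicator measurableSet_Icc,
    ← lintegral_sub_left_eq_self _ (y - w)]
  refine lintegral_congr fun s => ?_
  by_cases hs : s ∈ Icc 0 ε
  · have h1 : y - w - s ∈ Ioi (0 : ℝ) := by simp only [mem_Ioi]; linarith [hs.2]
    have h2 : w + (y - w - s) ∈ Icc (y - ε) y := ⟨by linarith [hs.2], by linarith [hs.1]⟩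
    rw [indicator_of_mem h1, indicator_of_mem hs, crossingProb,
      indicator_of_mem h2]
    congr 3
    ext ω
    rw [show y - (w + (y - w - s)) = s by ring]
  · have h2 : w + (y - w - s) ∉ Icc (y - ε) y := fun h => hs ⟨by linarith [h.2], by linarith [h.1]⟩
    rw [indicator_of_notMem hs, crossingProb, indicator_apply]
    simp [indicator_of_notMem h2]

/-- On the range of distances `[y - b, y - x]`, the density is uniformly close to its values at
slightly smaller distances. -/
lemma exists_modulus {u : ℝ → ℝ} (hu : ContinuousOn u (Ioi 0)) {x b y η : ℝ}
    (hby : b < y) (hη : 0 < η) :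
    ∃ δ > 0, δ < y - b ∧ ∀ w ∈ Icc x b, ∀ s ∈ Icc 0 δ, |u (y - w - s) - u (y - w)| ≤ η := by
  have hK : IsCompact (Icc ((y - b) / 2) (y - x)) := isCompact_Icc
  have huc := hK.uniformContinuousOn_of_continuous
    (hu.mono fun z hz => by simp only [mem_Ioi]; linarith [hz.1])
  obtain ⟨δ, hδ, H⟩ := Metric.uniformContinuousOn_iff.1 huc η hη
  have hby' : 0 < (y - b) / 2 := by linarith
  refine ⟨min (δ / 2) ((y - b) / 2), lt_min (by linarith) hby',
    (min_le_right _ _).trans_lt (by linarith), fun w hw s hs => ?_⟩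
  have hs1 := hs.2.trans (min_le_left _ _)
  have hs2 := hs.2.trans (min_le_right _ _)
  have := H (y - w - s) ⟨by linarith [hw.2], by linarith [hw.1, hs.1]⟩ (y - w)
    ⟨by linarith [hw.2], by linarith [hw.1]⟩ (by
      rw [Real.dist_eq, show y - w - s - (y - w) = -s by ring, abs_neg, abs_of_nonneg hs.1]
      linarith)
  exact (Real.dist_eq _ _ ▸ this).le

section Sandwich

variable {u : ℝ → ℝ} {w y η δ ε : ℝ}

/-- Replacing `u (y - w - s)` by `u (y - w)` costs at most `η` times the truncated mean. -/
lemma lintegral_mul_tail_le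
    (hmod : ∀ s ∈ Icc 0 δ, |u (y - w - s) - u (y - w)| ≤ η) (hεδ : ε ≤ δ) (h : ℝ≥0) :
    ∫⁻ s in Icc 0 ε, ENNReal.ofReal (u (y - w - s)) * P {ω | s < X h ω} ≤
      (ENNReal.ofReal (u (y - w)) + ENNReal.ofReal η) * truncatedMean P X h ε := by
  have hm : Measurable fun s : ℝ => P {ω | s < X h ω} :=
    (antitone_tail h).measurable
  rw [truncatedMean, ← lintegral_const_mul _ hm]
  refine setLIntegral_mono (hm.const_mul _) fun s hs => ?_
  gcongr
  refine le_trans (ENNReal.ofReal_le_ofReal ?_) ENNReal.ofReal_add_le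
  linarith [(abs_le.1 (hmod s ⟨hs.1, hs.2.trans hεδ⟩)).2]

lemma le_lintegral_mul_tail
    (hmod : ∀ s ∈ Icc 0 δ, |u (y - w - s) - u (y - w)| ≤ η) (hεδ : ε ≤ δ) (h : ℝ≥0) :
    ENNReal.ofReal (u (y - w)) * truncatedMean P X h ε ≤
      (∫⁻ s in Icc 0 ε, ENNReal.ofReal (u (y - w - s)) * P {ω | s < X h ω}) +
        ENNReal.ofReal η * truncatedMean P X h ε := by
  have hm : Measurable fun s : ℝ => P {ω | s < X h ω} :=
    (antitone_tail h).measurable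
  rw [truncatedMean, ← lintegral_const_mul _ hm, ← lintegral_const_mul _ hm,
    ← lintegral_add_right _ (hm.const_mul _)]
  refine setLIntegral_mono' measurableSet_Icc fun s hs => ?_
  rw [← add_mul]
  gcongr
  refine le_trans (ENNReal.ofReal_le_ofReal ?_) ENNReal.ofReal_add_le
  linarith [(abs_le.1 (hmod s ⟨hs.1, hs.2.trans hεδ⟩)).1]

end Sandwich

namespace IsSubordinator

lemma ae_le_startedAt (hX : IsSubordinator P X) (x : ℝ) :
    ∀ᵐ ω ∂P, ∀ t, x ≤ startedAt X x t ω := by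
  filter_upwards [hX.zero, hX.paths] with ω h0 hω t
  have : X 0 ω ≤ X t ω := hω.1 zero_le
  simp only [startedAt]
  linarith

lemma ae_paths_startedAt (hX : IsSubordinator P X) (x : ℝ) :
    ∀ᵐ ω ∂P, Monotone (fun t => startedAt X x t ω) ∧
      ∀ t, ContinuousWithinAt (fun s => startedAt X x s ω) (Ici t) t := by
  filter_upwards [hX.paths] with ω hω
  exact ⟨fun s t hst => add_le_add le_rfl (hω.1 hst), fun t => (hω.2 t).const_add x⟩

/-- A subordinator whose potential density is positive somewhere in `(0, ∞)` is not the zero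
process. -/
lemma truncatedMean_one_ne_zero [IsProbabilityMeasure P] (hX : IsSubordinator P X) {u : ℝ → ℝ}
    (hu : IsContinuousPotentialDensity P X u) {r : ℝ} (hr : 0 < r) (hpos : 0 < u r) {ε : ℝ}
    (hε : 0 < ε) : truncatedMean P X 1 ε ≠ 0 := by
  intro h0
  have hanti : Antitone fun s : ℝ => P {ω | s < X 1 ω} := antitone_tail 1
  -- The tail of `X 1` vanishes on `(0, ε]`, hence everywhere on `(0, ∞)` by monotonicity.
  have htail : ∀ s > 0, P {ω | s < X 1 ω} = 0 := by
    intro s hs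
    by_contra hne
    set m := min s ε
    have hle : P {ω | s < X 1 ω} * ENNReal.ofReal m ≤ truncatedMean P X 1 ε := by
      calc P {ω | s < X 1 ω} * ENNReal.ofReal m = ∫⁻ _ in Icc 0 m, P {ω | s < X 1 ω} := by
            rw [setLIntegral_const, Real.volume_Icc, sub_zero]
        _ ≤ ∫⁻ s' in Icc 0 m, P {ω | s' < X 1 ω} :=
            setLIntegral_mono hanti.measurable fun s' hs' => hanti (hs'.2.trans (min_le_left _ _))
        _ ≤ truncatedMean P X 1 ε :=
            lintegral_mono_set (Icc_subset_Icc_right (min_le_right _ _))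
    rw [h0, nonpos_iff_eq_zero, mul_eq_zero, ENNReal.ofReal_eq_zero] at hle
    exact hle.elim hne (not_le.2 (lt_min hs hε))
  have hone : ∀ᵐ ω ∂P, X 1 ω ≤ 0 := by
    have : ∀ᵐ ω ∂P, ∀ n : ℕ, ¬ 1 / ((n : ℝ) + 1) < X 1 ω :=
      ae_all_iff.2 fun n => measure_eq_zero_iff_ae_notMem.1 (htail _ (by positivity))
    filter_upwards [this] with ω hω
    by_contra! h
    obtain ⟨n, hn⟩ := exists_nat_one_div_lt h
    exact hω n hn
  -- Hence no increment over a unit of time moves the process, and the potential measure is zero.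
  have hnat : ∀ k : ℕ, ∀ᵐ ω ∂P, X k ω ≤ 0 := by
    intro k
    induction k with
    | zero => filter_upwards [hX.zero] with ω hω using by simp [hω]
    | succ k ih =>
      have hinc : ∀ᵐ ω ∂P, X (k + 1) ω - X k ω ∈ Iic (0 : ℝ) :=
        (hX.stationary_increments k 1).symm.ae_mem_snd measurableSet_Iic hone
      filter_upwards [ih, hinc] with ω h1 h2
      push_cast
      have := mem_Iic.1 h2
      linarith
  have hall : ∀ t, ∀ᵐ ω ∂P, X t ω ≤ 0 := by
    intro t
    filter_upwards [hnat ⌈t⌉₊, hX.paths] with ω h1 h2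
    exact (h2.1 (Nat.le_ceil t)).trans h1
  have hpot := hX.lintegral_potential hu (f := (Ioi (0 : ℝ)).indicator 1)
    (measurable_one.indicator measurableSet_Ioi) (fun z hz => by simp [hz])
  have hL : ∫⁻ v in Ici (0 : ℝ), ∫⁻ ω, (Ioi (0 : ℝ)).indicator 1 (X v.toNNReal ω) ∂P = 0 := by
    refine (lintegral_congr fun v => ?_).trans lintegral_zero
    refine (lintegral_congr_ae ?_).trans lintegral_zero
    filter_upwards [hall v.toNNReal] with ω hω
    simp [hω]
  rw [hL] at hpot
  have hmem : {z | 0 < u z} ∩ Ioi 0 ∈ 𝓝 r :=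
    inter_mem ((hu.continuousOn.continuousAt (Ioi_mem_nhds hr)).eventually (lt_mem_nhds hpos))
      (Ioi_mem_nhds hr)
  have hmeas : AEMeasurable (fun z => ENNReal.ofReal (u z) * (Ioi (0 : ℝ)).indicator 1 z)
      (volume.restrict (Ioi 0)) :=
    (hu.continuousOn.aemeasurable measurableSet_Ioi).ennreal_ofReal.mul
      (measurable_one.indicator measurableSet_Ioi).aemeasurable
  have hae := (lintegral_eq_zero_iff' hmeas).1 hpot.symm
  rw [EventuallyEq, ae_restrict_iff' measurableSet_Ioi] at hae
  refine (Measure.measure_pos_of_mem_nhds volume hmem).ne' (measure_mono_null ?_ hae)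
  rintro z ⟨hz1, hz2⟩ h
  have := h hz2
  simp only [indicator_of_mem hz2, Pi.one_apply, mul_one, Pi.zero_apply,
    ENNReal.ofReal_eq_zero] at this
  exact absurd hz1 (not_lt.2 this)

lemma passageScale_ne_zero [IsProbabilityMeasure P] (hX : IsSubordinator P X) {u : ℝ → ℝ}
    (hu : IsContinuousPotentialDensity P X u) {r : ℝ} (hr : 0 < r) (hpos : 0 < u r) {ε : ℝ}
    (hε : 0 < ε) : passageScale P X ε ≠ 0 := by
  intro h0
  have := ENNReal.iSup_eq_zero.1 h0 0
  simp only [Nat.cast_zero, zero_add, one_mul, div_one] at this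
  exact hX.truncatedMean_one_ne_zero hu hr hpos hε this

end IsSubordinator

/-! ### Two-sided bounds for the probability of passing `y` from nearby -/

namespace IsSubordinator

variable {u : ℝ → ℝ} {x b y η δ ε κ : ℝ} {t : ℝ≥0} {Λ : Set Ω}

lemma mul_setLIntegral_volume_passageWindow_le [IsProbabilityMeasure P] (hX : IsSubordinator P X)
    (hΛ : MeasurableSet Λ) (n : ℕ) :
    ((n : ℝ≥0∞) + 1) * ∫⁻ ω in Λ,
      volume (passageWindow (startedAt X x) y ε t (1 / ((n : ℝ≥0) + 1)) ω) ∂P ≤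
      P (Λ ∩ prePassageGE (startedAt X x) y (y - ε)) := by
  set A := prePassageGE (startedAt X x) y (y - ε)
  set h : ℝ≥0 := 1 / ((n : ℝ≥0) + 1) with hh
  have hle : ∫⁻ ω in Λ, volume (passageWindow (startedAt X x) y ε t h ω) ∂P ≤
      h * P (Λ ∩ A) := by
    -- The event `A` is not known to be measurable, hence the measurable hull.
    rw [← measure_toMeasurable (Λ ∩ A), ← lintegral_indicator hΛ,
      ← lintegral_indicator_const (measurableSet_toMeasurable P (Λ ∩ A))]
    refine lintegral_mono_ae ?_
    filter_upwards [hX.ae_paths_startedAt x] with ω hω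
    by_cases h1 : ω ∈ Λ
    · rw [indicator_of_mem h1]
      refine (volume_passageWindow_le hω.1).trans ?_
      by_cases h2 : ω ∈ A
      · rw [indicator_of_mem h2, indicator_of_mem (subset_toMeasurable P (Λ ∩ A) ⟨h1, h2⟩)]
      · simp [A, indicator_of_notMem h2]
    · simp [h1]
  calc _ ≤ ((n : ℝ≥0∞) + 1) * (h * P (Λ ∩ A)) := by gcongr
    _ = P (Λ ∩ A) := by
      have : ((n : ℝ≥0∞) + 1) * (h : ℝ≥0∞) = 1 := by
        have : ((n : ℝ≥0) + 1) * h = 1 := by rw [hh]; field_simp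
        exact_mod_cast congrArg ((↑) : ℝ≥0 → ℝ≥0∞) this
      rw [← mul_assoc, this, one_mul]

/-- The lower bound. Here `δ` and `η` come from the uniform continuity of `u` (`exists_modulus`). It
is stated for each `n` separately, since it also serves to show that the supremum over `n` is
finite. -/
lemma setLIntegral_mul_le [IsProbabilityMeasure P] (hX : IsSubordinator P X)
    (hu : IsContinuousPotentialDensity P X u)
    (hΛ : MeasurableSet[Filtration.natural (startedAt X x) (hX.stronglyMeasurable_startedAt x) t] Λ)
    (hΛb : ∀ ω ∈ Λ, startedAt X x t ω ≤ b) (hδ : δ < y - b)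
    (hmod : ∀ w ∈ Icc x b, ∀ s ∈ Icc 0 δ, |u (y - w - s) - u (y - w)| ≤ η)
    (hεδ : ε ≤ δ) (n : ℕ) :
    (∫⁻ ω in Λ, ENNReal.ofReal (u (y - startedAt X x t ω)) ∂P) *
        (((n : ℝ≥0∞) + 1) * truncatedMean P X (1 / ((n : ℝ≥0) + 1)) ε) ≤
      P (Λ ∩ prePassageGE (startedAt X x) y (y - ε)) +
        ENNReal.ofReal η * (((n : ℝ≥0∞) + 1) * truncatedMean P X (1 / ((n : ℝ≥0) + 1)) ε) := by
  set h : ℝ≥0 := 1 / ((n : ℝ≥0) + 1)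
  have hΛ' : MeasurableSet Λ := Filtration.le _ t _ hΛ
  set T := truncatedMean P X h ε with hT
  have hTt : T ≠ ⊤ := truncatedMean_ne_top h ε
  have key : (∫⁻ ω in Λ, ENNReal.ofReal (u (y - startedAt X x t ω)) ∂P) * T ≤
      (∫⁻ ω in Λ, volume (passageWindow (startedAt X x) y ε t h ω) ∂P) +
        ENNReal.ofReal η * T := by
    calc _ = ∫⁻ ω in Λ, ENNReal.ofReal (u (y - startedAt X x t ω)) * T ∂P :=
          (lintegral_mul_const' _ _ hTt).symm
      _ ≤ ∫⁻ ω in Λ, ((∫⁻ z in Ioi (0 : ℝ), ENNReal.ofReal (u z) *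
            crossingProb P X y ε h (startedAt X x t ω + z)) + ENNReal.ofReal η * T) ∂P := by
          refine lintegral_mono_ae ((ae_restrict_iff' hΛ').2 ?_)
          filter_upwards [hX.ae_le_startedAt x] with ω hω hωΛ
          rw [lintegral_mul_crossingProb u (by linarith [hΛb ω hωΛ])]
          exact le_lintegral_mul_tail (hmod _ ⟨hω t, hΛb ω hωΛ⟩) hεδ h
      _ = (∫⁻ ω in Λ, volume (passageWindow (startedAt X x) y ε t h ω) ∂P) +
            ENNReal.ofReal η * T * P Λ := by
          rw [lintegral_add_right _ measurable_const, setLIntegral_const,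
            hX.lintegral_volume_passageWindow hu (by linarith) t h hΛ hΛb]
      _ ≤ _ := add_le_add le_rfl (mul_le_of_le_one_right zero_le prob_le_one)
  calc _ = ((n : ℝ≥0∞) + 1) *
        ((∫⁻ ω in Λ, ENNReal.ofReal (u (y - startedAt X x t ω)) ∂P) * T) := by ring
    _ ≤ ((n : ℝ≥0∞) + 1) *
        ((∫⁻ ω in Λ, volume (passageWindow (startedAt X x) y ε t h ω) ∂P) +
          ENNReal.ofReal η * T) := by gcongr
    _ = ((n : ℝ≥0∞) + 1) * (∫⁻ ω in Λ, volume (passageWindow (startedAt X x) y ε t h ω) ∂P) +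
          ENNReal.ofReal η * (((n : ℝ≥0∞) + 1) * T) := by ring
    _ ≤ _ := by
        gcongr
        exact hX.mul_setLIntegral_volume_passageWindow_le hΛ' n

/-- The upper bound, by Fatou's lemma. The window has to be enlarged from `ε` to `(1 + κ) ε`, which
costs no more than a factor `1 + κ`. -/
lemma measure_inter_prePassageGE_le [IsProbabilityMeasure P] (hX : IsSubordinator P X)
    (hu : IsContinuousPotentialDensity P X u)
    (hΛ : MeasurableSet[Filtration.natural (startedAt X x) (hX.stronglyMeasurable_startedAt x) t] Λ)
    (hΛb : ∀ ω ∈ Λ, startedAt X x t ω ≤ b) (hby : b < y) (hδ : δ < y - b)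
    (hmod : ∀ w ∈ Icc x b, ∀ s ∈ Icc 0 δ, |u (y - w - s) - u (y - w)| ≤ η)
    (hε : 0 < ε) (hκ : 0 < κ) (hεδ : (1 + κ) * ε ≤ δ) :
    P (Λ ∩ prePassageGE (startedAt X x) y (y - ε)) ≤
      ((∫⁻ ω in Λ, ENNReal.ofReal (u (y - startedAt X x t ω)) ∂P) + ENNReal.ofReal η) *
        ((1 + ENNReal.ofReal κ) * passageScale P X ε) := by
  set A := prePassageGE (startedAt X x) y (y - ε)
  set ε' := (1 + κ) * ε with hε'
  set I := ∫⁻ ω in Λ, ENNReal.ofReal (u (y - startedAt X x t ω)) ∂P with hI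
  have hεε' : ε < ε' := by nlinarith
  have hΛ' : MeasurableSet Λ := Filtration.le _ t _ hΛ
  set V : ℕ → Ω → ℝ≥0∞ := fun n ω => ((n : ℝ≥0∞) + 1) *
    volume (passageWindow (startedAt X x) y ε' t (1 / ((n : ℝ≥0) + 1)) ω) with hV
  have hVm : ∀ n, AEMeasurable (V n) (P.restrict Λ) := fun n =>
    ((hX.aemeasurable_volume_passageWindow x y ε' t _).1.const_mul _).restrict
  have hbound : ∀ n, ∫⁻ ω in Λ, V n ω ∂P ≤
      (I + ENNReal.ofReal η) * ((1 + ENNReal.ofReal κ) * passageScale P X ε) := by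
    intro n
    set h : ℝ≥0 := 1 / ((n : ℝ≥0) + 1) with hh
    set T := truncatedMean P X h ε' with hT
    have hTt : T ≠ ⊤ := truncatedMean_ne_top h ε'
    have h1 : ∫⁻ ω in Λ, volume (passageWindow (startedAt X x) y ε' t h ω) ∂P ≤
        (I + ENNReal.ofReal η) * T := by
      calc _ = ∫⁻ ω in Λ, (∫⁻ z in Ioi (0 : ℝ), ENNReal.ofReal (u z) *
              crossingProb P X y ε' h (startedAt X x t ω + z)) ∂P :=
            hX.lintegral_volume_passageWindow hu (by linarith) t h hΛ hΛb
        _ ≤ ∫⁻ ω in Λ, (ENNReal.ofReal (u (y - startedAt X x t ω)) + ENNReal.ofReal η) * T ∂P := by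
            refine lintegral_mono_ae ((ae_restrict_iff' hΛ').2 ?_)
            filter_upwards [hX.ae_le_startedAt x] with ω hω hωΛ
            rw [lintegral_mul_crossingProb u (by linarith [hΛb ω hωΛ])]
            exact lintegral_mul_tail_le (hmod _ ⟨hω t, hΛb ω hωΛ⟩) hεδ h
        _ = (I + ENNReal.ofReal η * P Λ) * T := by
            rw [lintegral_mul_const' _ _ hTt, lintegral_add_right _ measurable_const,
              setLIntegral_const]
        _ ≤ _ := by
            gcongr
            exact mul_le_of_le_one_right zero_le prob_le_one
    calc ∫⁻ ω in Λ, V n ω ∂P = ((n : ℝ≥0∞) + 1) *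
          ∫⁻ ω in Λ, volume (passageWindow (startedAt X x) y ε' t h ω) ∂P :=
          lintegral_const_mul' _ _ (by simp)
      _ ≤ ((n : ℝ≥0∞) + 1) * ((I + ENNReal.ofReal η) *
            ((1 + ENNReal.ofReal κ) * truncatedMean P X h ε)) := by
          gcongr
          exact h1.trans (by gcongr; exact truncatedMean_mul_le h hε.le hκ.le)
      _ = (I + ENNReal.ofReal η) * ((1 + ENNReal.ofReal κ) *
            (((n : ℝ≥0∞) + 1) * truncatedMean P X h ε)) := by ring
      _ ≤ _ := by
          gcongr
          exact le_iSup (fun n : ℕ =>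
            ((n : ℝ≥0∞) + 1) * truncatedMean P X (1 / ((n : ℝ≥0) + 1)) ε) n
  have hLm : AEMeasurable (fun ω => liminf (fun n => V n ω) atTop) (P.restrict Λ) := by
    refine ⟨fun ω => liminf (fun n => (hVm n).mk _ ω) atTop,
      Measurable.liminf fun n => (hVm n).measurable_mk, ?_⟩
    filter_upwards [ae_all_iff.2 fun n => (hVm n).ae_eq_mk] with ω hω
    simp only [hω]
  have hone : ∀ᵐ ω ∂P.restrict Λ, ω ∈ A → 1 ≤ liminf (fun n => V n ω) atTop := by
    refine (ae_restrict_iff' hΛ').2 ?_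
    filter_upwards [hX.ae_paths_startedAt x] with ω hω hωΛ hωA
    exact one_le_liminf_volume_passageWindow hω.1 hεε' (hω.2 t)
      ((hΛb ω hωΛ).trans_lt hby) hωA
  calc P (Λ ∩ A) = P.restrict Λ A := by rw [Measure.restrict_apply' hΛ', inter_comm]
    _ ≤ P.restrict Λ {ω | 1 ≤ liminf (fun n => V n ω) atTop} := measure_mono_ae hone
    _ ≤ ∫⁻ ω in Λ, liminf (fun n => V n ω) atTop ∂P :=
        meas_le_lintegral₀ hLm fun _ h => h
    _ ≤ liminf (fun n => ∫⁻ ω in Λ, V n ω ∂P) atTop := lintegral_liminf_le' hVm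
    _ ≤ _ := liminf_le_of_le (by isBoundedDefault) fun c hc =>
        (hc.exists.choose_spec).trans (hbound _)

end IsSubordinator

/-! ### The limit of the scaled probabilities -/

namespace IsSubordinator

variable {u : ℝ → ℝ} {x b y η δ ε κ : ℝ} {t : ℝ≥0} {A : Set Ω}

lemma ae_mem_beforePassage_iff (hX : IsSubordinator P X) (x b : ℝ) (t : ℝ≥0) :
    ∀ᵐ ω ∂P, ω ∈ beforePassage (startedAt X x) b t ↔
      ω ∈ ⋃ k : ℕ, {ω | startedAt X x (t + 1 / ((k : ℝ≥0) + 1)) ω ≤ b} := by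
  filter_upwards [hX.ae_paths_startedAt x] with ω hω
  rw [mem_iUnion]
  exact mem_beforePassage_iff hω.1

lemma nullMeasurableSet_beforePassage (hX : IsSubordinator P X) (x b : ℝ) (t : ℝ≥0) :
    NullMeasurableSet (beforePassage (startedAt X x) b t) P :=
  (MeasurableSet.iUnion fun _ => measurableSet_le ((hX.measurable _).const_add x)
    measurable_const).nullMeasurableSet.congr
      (Filter.eventuallyEq_set.2 (hX.ae_mem_beforePassage_iff x b t)).symm

lemma measurableSet_inter_le (hX : IsSubordinator P X)
    (hA : MeasurableSet[Filtration.natural (startedAt X x) (hX.stronglyMeasurable_startedAt x) t] A)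
    {s : ℝ≥0} (hts : t ≤ s) :
    MeasurableSet[Filtration.natural (startedAt X x) (hX.stronglyMeasurable_startedAt x) s]
      (A ∩ {ω | startedAt X x s ω ≤ b}) :=
  (Filtration.mono _ hts _ hA).inter
    ((Filtration.stronglyAdapted_natural (hX.stronglyMeasurable_startedAt x) s).measurable
      measurableSet_Iic)

/-- The event `A ∩ {t < τ_b⁺}` is approximated from inside, as `s ↓ t`, by the events
`A ∩ {Y_s ≤ b}`. -/
lemma tendsto_measure_approx (hX : IsSubordinator P X) (x b : ℝ) (t : ℝ≥0) (A B : Set Ω) :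
    Tendsto (fun k : ℕ => P (A ∩ {ω | startedAt X x (t + 1 / ((k : ℝ≥0) + 1)) ω ≤ b} ∩ B))
      atTop (𝓝 (P (A ∩ beforePassage (startedAt X x) b t ∩ B))) := by
  set G := {ω | Monotone fun t => startedAt X x t ω} with hG
  have hGae : ∀ᵐ ω ∂P, ω ∈ G := (hX.ae_paths_startedAt x).mono fun ω h => h.1
  have hcongr : ∀ S : Set Ω, P S = P (S ∩ G) := fun S =>
    (measure_congr (Filter.eventuallyEq_set.2 (hGae.mono fun ω h => by simp [h]))).symm
  simp_rw [fun k : ℕ =>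
    hcongr (A ∩ {ω | startedAt X x (t + 1 / ((k : ℝ≥0) + 1)) ω ≤ b} ∩ B),
    hcongr (A ∩ beforePassage (startedAt X x) b t ∩ B)]
  have hU : A ∩ beforePassage (startedAt X x) b t ∩ B ∩ G =
      ⋃ k : ℕ, A ∩ {ω | startedAt X x (t + 1 / ((k : ℝ≥0) + 1)) ω ≤ b} ∩ B ∩ G := by
    ext ω
    simp only [mem_iUnion, mem_inter_iff]
    constructor
    · rintro ⟨⟨⟨h1, h2⟩, h3⟩, h4⟩
      obtain ⟨k, hk⟩ := (mem_beforePassage_iff h4).1 h2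
      exact ⟨k, ⟨⟨h1, hk⟩, h3⟩, h4⟩
    · rintro ⟨k, ⟨⟨h1, hk⟩, h3⟩, h4⟩
      exact ⟨⟨⟨h1, (mem_beforePassage_iff h4).2 ⟨k, hk⟩⟩, h3⟩, h4⟩
  rw [hU]
  refine tendsto_measure_iUnion_atTop ?_
  rintro k l hkl ω ⟨⟨⟨h1, hk⟩, h3⟩, h4⟩
  refine ⟨⟨⟨h1, ?_⟩, h3⟩, h4⟩
  refine le_trans (h4 ?_) hk
  gcongr

/-- The weights `u (y - Y_s)` converge along the same approximation, by the right-continuity of the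
paths. -/
lemma tendsto_setLIntegral_approx [IsProbabilityMeasure P] (hX : IsSubordinator P X)
    (hu : ContinuousOn u (Ioi 0)) (hby : b < y) (hA : MeasurableSet A) :
    Tendsto (fun k : ℕ => ∫⁻ ω in A ∩ {ω | startedAt X x (t + 1 / ((k : ℝ≥0) + 1)) ω ≤ b},
        ENNReal.ofReal (u (y - startedAt X x (t + 1 / ((k : ℝ≥0) + 1)) ω)) ∂P)
      atTop (𝓝 (∫⁻ ω in A ∩ beforePassage (startedAt X x) b t,
        ENNReal.ofReal (u (y - startedAt X x t ω)) ∂P)) := by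
  set s : ℕ → ℝ≥0 := fun k => t + 1 / ((k : ℝ≥0) + 1) with hs
  set Y := startedAt X x with hY
  have hYm : ∀ r, Measurable (Y r) := fun r => (hX.measurable r).const_add x
  have hΛ : ∀ k, MeasurableSet (A ∩ {ω | Y (s k) ω ≤ b}) := fun k =>
    hA.inter (measurableSet_le (hYm _) measurable_const)
  have hΛ0 : NullMeasurableSet (A ∩ beforePassage Y b t) P :=
    hA.nullMeasurableSet.inter (hX.nullMeasurableSet_beforePassage x b t)
  have hst : Tendsto s atTop (𝓝[≥] t) := by
    refine tendsto_nhdsWithin_iff.2 ⟨?_, Eventually.of_forall fun k => mem_Ici.2 le_self_add⟩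
    simpa [hs] using (tendsto_const_nhds (x := t)).add
      (tendsto_one_div_add_atTop_nhds_zero_nat (𝕜 := ℝ≥0))
  obtain ⟨M, hM⟩ := (isCompact_Icc (a := y - b) (b := y - x)).exists_bound_of_continuousOn
    (hu.mono fun z hz => by simp only [mem_Ioi]; linarith [hz.1])
  -- `u` is only continuous on `(0, ∞)`: compose with a clamping into `[y - b, ∞)`.
  set u' : ℝ → ℝ := fun z => u (max z (y - b)) with hu'
  have hu'c : Continuous u' := hu.comp_continuous (by fun_prop)
    fun z => lt_of_lt_of_le (sub_pos.2 hby) (le_max_right _ _)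
  have hu'e : ∀ w ≤ b, u (y - w) = u' (y - w) := fun w hw => by
    rw [hu']; simp only; rw [max_eq_left (by linarith)]
  have h0 : ∫⁻ ω in A ∩ beforePassage Y b t, ENNReal.ofReal (u (y - Y t ω)) ∂P =
      ∫⁻ ω, (A ∩ beforePassage Y b t).indicator
        (fun ω => ENNReal.ofReal (u' (y - Y t ω))) ω ∂P := by
    rw [← lintegral_indicator₀ hΛ0]
    refine lintegral_congr fun ω => ?_
    by_cases h : ω ∈ A ∩ beforePassage Y b t
    · rw [indicator_of_mem h, indicator_of_mem h, hu'e _ (le_of_lt_passageTime h.2)]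
    · rw [indicator_of_notMem h, indicator_of_notMem h]
  have hk : ∀ k, ∫⁻ ω in A ∩ {ω | Y (s k) ω ≤ b}, ENNReal.ofReal (u (y - Y (s k) ω)) ∂P =
      ∫⁻ ω, (A ∩ {ω | Y (s k) ω ≤ b}).indicator
        (fun ω => ENNReal.ofReal (u' (y - Y (s k) ω))) ω ∂P := by
    intro k
    rw [← lintegral_indicator (hΛ k)]
    refine lintegral_congr fun ω => ?_
    by_cases h : ω ∈ A ∩ {ω | Y (s k) ω ≤ b}
    · rw [indicator_of_mem h, indicator_of_mem h, hu'e _ h.2]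
    · rw [indicator_of_notMem h, indicator_of_notMem h]
  rw [h0]
  refine Tendsto.congr (fun k => (hk k).symm) ?_
  refine tendsto_lintegral_of_dominated_convergence' (fun _ => ENNReal.ofReal M)
    (fun k => ?_) (fun k => ?_) (by simp) ?_
  · exact ((ENNReal.measurable_ofReal.comp (hu'c.measurable.comp
      (measurable_const.sub (hYm _)))).indicator (hΛ k)).aemeasurable
  · filter_upwards [hX.ae_le_startedAt x] with ω hω
    by_cases h : ω ∈ A ∩ {ω | Y (s k) ω ≤ b}
    · have hb : Y (s k) ω ≤ b := h.2
      rw [indicator_of_mem h, ← hu'e _ hb]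
      exact ENNReal.ofReal_le_ofReal ((le_abs_self _).trans
        (hM _ ⟨by linarith, by linarith [hω (s k)]⟩))
    · rw [indicator_of_notMem h]
      exact zero_le
  · filter_upwards [hX.ae_paths_startedAt x] with ω hω
    by_cases h : ω ∈ A ∩ beforePassage Y b t
    · obtain ⟨k₀, hk₀⟩ := (mem_beforePassage_iff hω.1).1 h.2
      have hev : ∀ᶠ k in atTop, ω ∈ A ∩ {ω | Y (s k) ω ≤ b} := by
        filter_upwards [eventually_ge_atTop k₀] with k hk
        refine ⟨h.1, le_trans (hω.1 ?_) hk₀⟩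
        simp only [hs]
        gcongr
      rw [indicator_of_mem h]
      have hlim : Tendsto (fun k => ENNReal.ofReal (u' (y - Y (s k) ω))) atTop
          (𝓝 (ENNReal.ofReal (u' (y - Y t ω)))) :=
        (ENNReal.continuous_ofReal.comp hu'c).continuousAt.tendsto.comp
          (tendsto_const_nhds.sub ((hω.2 t).tendsto.comp hst))
      refine hlim.congr' (hev.mono fun k hk => ?_)
      beta_reduce
      rw [indicator_of_mem hk]
    · rw [indicator_of_notMem h]
      have hk : ∀ k, ω ∉ A ∩ {ω | Y (s k) ω ≤ b} := fun k hk =>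
        h ⟨hk.1, (mem_beforePassage_iff hω.1).2 ⟨k, hk.2⟩⟩
      refine tendsto_const_nhds.congr fun k => ?_
      rw [indicator_of_notMem (hk k)]

lemma setLIntegral_beforePassage_ne_top [IsProbabilityMeasure P] (hX : IsSubordinator P X)
    (hu : ContinuousOn u (Ioi 0)) (hby : b < y) (hA : MeasurableSet A) :
    ∫⁻ ω in A ∩ beforePassage (startedAt X x) b t,
      ENNReal.ofReal (u (y - startedAt X x t ω)) ∂P ≠ ⊤ := by
  obtain ⟨M, hM⟩ := (isCompact_Icc (a := y - b) (b := y - x)).exists_bound_of_continuousOn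
    (hu.mono fun z hz => by simp only [mem_Ioi]; linarith [hz.1])
  have hΛ0 : NullMeasurableSet (A ∩ beforePassage (startedAt X x) b t) P :=
    hA.nullMeasurableSet.inter (hX.nullMeasurableSet_beforePassage x b t)
  refine ne_of_lt (lt_of_le_of_lt (lintegral_mono_ae (g := fun _ => ENNReal.ofReal M)
    ((ae_restrict_iff'₀ hΛ0).2 ?_)) (by simp [ENNReal.mul_lt_top]))
  filter_upwards [hX.ae_le_startedAt x] with ω hω h
  have := le_of_lt_passageTime h.2
  exact ENNReal.ofReal_le_ofReal ((le_abs_self _).trans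
    (hM _ ⟨by linarith, by linarith [hω t]⟩))

lemma ae_mem_beforePassage_zero (hX : IsSubordinator P X) (hxb : x < b) :
    ∀ᵐ ω ∂P, ω ∈ beforePassage (startedAt X x) b 0 := by
  filter_upwards [hX.zero, hX.ae_paths_startedAt x] with ω h0 hω
  have h : startedAt X x 0 ω < b := by simpa [startedAt, h0] using hxb
  refine (show ((0 : ℝ≥0) : WithTop ℝ≥0) < passageTime (startedAt X x) b ω from ?_)
  refine lt_of_not_ge fun hle => ?_
  obtain ⟨τ, hτ⟩ := WithTop.ne_top_iff_exists.1 (ne_top_of_le_ne_top WithTop.coe_ne_top hle)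
  have := lt_of_passageTime_eq hω.1 (hω.2 0) h hτ.symm
  rw [← hτ] at hle
  exact absurd this (not_lt.2 (WithTop.coe_le_coe.1 hle))

/-- The scale is finite for small `ε`. -/
lemma eventually_passageScale_ne_top [IsProbabilityMeasure P] (hX : IsSubordinator P X)
    (hu : IsContinuousPotentialDensity P X u) (hxy : x < y) (hpos : 0 < u (y - x)) :
    ∀ᶠ ε in 𝓝[>] (0 : ℝ), passageScale P X ε ≠ ⊤ := by
  set b := (x + y) / 2 with hb
  -- With `η = u (y - x) / 2` the error term of the lower bound can be absorbed.
  have hη : 0 < u (y - x) / 2 := by linarith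
  obtain ⟨δ, hδ0, hδ, hmod⟩ := exists_modulus (x := x) (b := b) (y := y) hu.continuousOn
    (by linarith) hη
  filter_upwards [Ioc_mem_nhdsGT hδ0] with ε hε
  have hI : ∫⁻ ω in univ ∩ {ω | startedAt X x 0 ω ≤ b},
      ENNReal.ofReal (u (y - startedAt X x 0 ω)) ∂P = ENNReal.ofReal (u (y - x)) := by
    have hae : ∀ᵐ ω ∂P, startedAt X x 0 ω = x := by
      filter_upwards [hX.zero] with ω hω using by simp [startedAt, hω]
    rw [Measure.restrict_eq_self_of_ae_mem (by
      filter_upwards [hae] with ω hω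
      exact ⟨mem_univ _, by simp only [mem_ofPred_eq, hω]; linarith⟩),
      lintegral_congr_ae (g := fun _ => ENNReal.ofReal (u (y - x)))
        (hae.mono fun ω hω => by simp only [hω])]
    simp
  refine ne_top_of_le_ne_top (b := (ENNReal.ofReal (u (y - x) / 2))⁻¹)
    (by simpa using hη) (iSup_le fun n => ?_)
  have h := hX.setLIntegral_mul_le (t := 0) (b := b) (Λ := univ ∩ {ω | startedAt X x 0 ω ≤ b})
    hu (hX.measurableSet_inter_le MeasurableSet.univ le_rfl)
    (fun ω hω => hω.2) hδ hmod hε.2 n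
  rw [hI] at h
  set G := ((n : ℝ≥0∞) + 1) * truncatedMean P X (1 / ((n : ℝ≥0) + 1)) ε with hG
  have hGt : G ≠ ⊤ := ENNReal.mul_ne_top (by simp) (truncatedMean_ne_top _ _)
  rw [ENNReal.le_inv_iff_mul_le]
  have hsplit : ENNReal.ofReal (u (y - x)) =
      ENNReal.ofReal (u (y - x) / 2) + ENNReal.ofReal (u (y - x) / 2) := by
    rw [← ENNReal.ofReal_add hη.le hη.le]
    congr 1
    ring
  rw [hsplit, add_mul] at h
  rw [mul_comm]
  exact (ENNReal.le_of_add_le_add_right (ENNReal.mul_ne_top ENNReal.ofReal_ne_top hGt) h).trans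
    prob_le_one

/-- The probability of `A ∩ {t < τ_b⁺}` together with a passage over `y` from within distance `ε`,
divided by the scale, converges as `ε ↓ 0`. -/
lemma tendsto_measure_div_passageScale [IsProbabilityMeasure P] (hX : IsSubordinator P X)
    (hu : IsContinuousPotentialDensity P X u) (hxy : x < y) (hby : b < y) (hpos : 0 < u (y - x))
    (hA : MeasurableSet[Filtration.natural (startedAt X x)
      (hX.stronglyMeasurable_startedAt x) t] A) :
    Tendsto (fun ε => P (A ∩ beforePassage (startedAt X x) b t ∩
        prePassageGE (startedAt X x) y (y - ε)) / passageScale P X ε) (𝓝[>] 0)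
      (𝓝 (∫⁻ ω in A ∩ beforePassage (startedAt X x) b t,
        ENNReal.ofReal (u (y - startedAt X x t ω)) ∂P)) := by
  have hA' : MeasurableSet A := Filtration.le _ t _ hA
  have hIt := hX.setLIntegral_beforePassage_ne_top (x := x) (t := t) hu.continuousOn hby hA'
  have hIk := hX.tendsto_setLIntegral_approx (x := x) (t := t) hu.continuousOn hby hA'
  set I := ∫⁻ ω in A ∩ beforePassage (startedAt X x) b t,
    ENNReal.ofReal (u (y - startedAt X x t ω)) ∂P
  set q := fun ε => P (A ∩ beforePassage (startedAt X x) b t ∩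
    prePassageGE (startedAt X x) y (y - ε)) with hq
  have hmeas := fun k : ℕ => hX.measurableSet_inter_le (b := b) hA
    (le_self_add (a := t) (b := 1 / ((k : ℝ≥0) + 1)))
  have hbounds : ∀ η > 0, ∀ᶠ ε in 𝓝[>] (0 : ℝ),
      I ≤ q ε / passageScale P X ε + ENNReal.ofReal η ∧
      q ε / passageScale P X ε ≤ (I + ENNReal.ofReal η) * (1 + ENNReal.ofReal η) := by
    intro η hη
    obtain ⟨δ, hδ0, hδ, hmod⟩ := exists_modulus (x := x) hu.continuousOn hby hη
    have hδ' : 0 < δ / (1 + η) := by positivity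
    filter_upwards [Ioc_mem_nhdsGT hδ', hX.eventually_passageScale_ne_top hu hxy hpos]
      with ε hε hSt
    have hS0 := hX.passageScale_ne_zero hu (sub_pos.2 hxy) hpos hε.1
    have hεδ : (1 + η) * ε ≤ δ := by
      have := (le_div_iff₀ (by positivity : 0 < 1 + η)).1 hε.2
      linarith
    have hεδ' : ε ≤ δ := by nlinarith [hε.1]
    have hqk := hX.tendsto_measure_approx x b t A (prePassageGE (startedAt X x) y (y - ε))
    set S := passageScale P X ε with hS
    -- Both bounds hold for the approximating events at the times `s > t`; let `s ↓ t`.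
    constructor
    · have h1 : I * S ≤ q ε + ENNReal.ofReal η * S := by
        rw [hS, passageScale, ENNReal.mul_iSup]
        refine iSup_le fun n => ?_
        have hGt : ((n : ℝ≥0∞) + 1) * truncatedMean P X (1 / ((n : ℝ≥0) + 1)) ε ≠ ⊤ :=
          ENNReal.mul_ne_top (by simp) (truncatedMean_ne_top _ _)
        refine (le_of_tendsto_of_tendsto'
          (ENNReal.Tendsto.mul_const hIk (Or.inr hGt)) (hqk.add_const _) fun k =>
            hX.setLIntegral_mul_le hu (hmeas k) (fun ω hω => hω.2) hδ hmod hεδ' n).trans ?_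
        gcongr
        exact le_iSup (fun n : ℕ =>
          ((n : ℝ≥0∞) + 1) * truncatedMean P X (1 / ((n : ℝ≥0) + 1)) ε) n
      calc I = I * S / S := (ENNReal.mul_div_cancel_right hS0 hSt).symm
        _ ≤ (q ε + ENNReal.ofReal η * S) / S := by gcongr
        _ = q ε / S + ENNReal.ofReal η := by
          rw [ENNReal.add_div, ENNReal.mul_div_cancel_right hS0 hSt]
    · rw [ENNReal.div_le_iff hS0 hSt, mul_assoc]
      refine le_of_tendsto_of_tendsto' hqk
        (ENNReal.Tendsto.mul_const (hIk.add_const _)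
          (Or.inr (ENNReal.mul_ne_top (by simp) hSt))) fun k =>
        hX.measure_inter_prePassageGE_le hu (hmeas k) (fun ω hω => hω.2) hby hδ hmod hε.1 hη hεδ
  refine tendsto_order.2 ⟨fun c hc => ?_, fun c hc => ?_⟩
  · obtain ⟨η, hη, hcη⟩ : ∃ η : ℝ, 0 < η ∧ c + ENNReal.ofReal η < I := by
      have hlim : Tendsto (fun η : ℝ => c + ENNReal.ofReal η) (𝓝[>] 0) (𝓝 (c + 0)) := by
        refine tendsto_const_nhds.add ?_
        rw [← ENNReal.ofReal_zero]
        exact (ENNReal.continuous_ofReal.tendsto 0).mono_left nhdsWithin_le_nhds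
      rw [add_zero] at hlim
      obtain ⟨η, h1, h2⟩ := ((hlim.eventually (gt_mem_nhds hc)).and self_mem_nhdsWithin).exists
      exact ⟨η, h2, h1⟩
    filter_upwards [hbounds η hη] with ε hε
    exact lt_of_add_lt_add_right (hcη.trans_le hε.1)
  · obtain ⟨η, hη, hcη⟩ : ∃ η : ℝ, 0 < η ∧
        (I + ENNReal.ofReal η) * (1 + ENNReal.ofReal η) < c := by
      have hlim0 : Tendsto (fun η : ℝ => ENNReal.ofReal η) (𝓝[>] 0) (𝓝 0) := by
        rw [← ENNReal.ofReal_zero]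
        exact (ENNReal.continuous_ofReal.tendsto 0).mono_left nhdsWithin_le_nhds
      have hlim : Tendsto (fun η : ℝ => (I + ENNReal.ofReal η) * (1 + ENNReal.ofReal η))
          (𝓝[>] 0) (𝓝 ((I + 0) * (1 + 0))) :=
        ENNReal.Tendsto.mul (tendsto_const_nhds.add hlim0) (Or.inr (by simp))
          (tendsto_const_nhds.add hlim0) (Or.inr (by simpa using hIt))
      rw [add_zero, add_zero, mul_one] at hlim
      obtain ⟨η, h1, h2⟩ := ((hlim.eventually (gt_mem_nhds hc)).and self_mem_nhdsWithin).exists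
      exact ⟨η, h2, h1⟩
    filter_upwards [hbounds η hη] with ε hε
    exact hε.2.trans_lt hcη

/-- The normalising constants: the case of the sure event at time `0`. -/
lemma tendsto_measure_prePassageGE_div_passageScale [IsProbabilityMeasure P]
    (hX : IsSubordinator P X) (hu : IsContinuousPotentialDensity P X u) (hxy : x < y)
    (hpos : 0 < u (y - x)) :
    Tendsto (fun ε => P (prePassageGE (startedAt X x) y (y - ε)) / passageScale P X ε) (𝓝[>] 0)
      (𝓝 (ENNReal.ofReal (u (y - x)))) := by
  obtain ⟨b, hxb, hby⟩ := exists_between hxy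
  have h := hX.tendsto_measure_div_passageScale (A := univ) (t := 0) hu hxy hby hpos
    MeasurableSet.univ
  have hmem := hX.ae_mem_beforePassage_zero hxb
  convert h using 2
  · congr 1
    refine measure_congr (Filter.eventuallyEq_set.2 ?_)
    filter_upwards [hmem] with ω hω
    simp [hω]
  · rw [univ_inter, Measure.restrict_eq_self_of_ae_mem hmem,
      lintegral_congr_ae (g := fun _ => ENNReal.ofReal (u (y - x)))]
    · simp
    · filter_upwards [hX.zero] with ω hω
      simp [startedAt, hω]

lemma measure_prePassageGE_pos [IsProbabilityMeasure P]
    (hX : IsSubordinator P X) (hu : IsContinuousPotentialDensity P X u) (hxy : x < y)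
    (hpos : 0 < u (y - x)) (hε : 0 < ε) : 0 < P (prePassageGE (startedAt X x) y (y - ε)) := by
  have h := (hX.tendsto_measure_prePassageGE_div_passageScale hu hxy hpos).eventually
    (lt_mem_nhds (ENNReal.ofReal_pos.2 hpos))
  obtain ⟨ε', h1, h2⟩ := (h.and (Ioc_mem_nhdsGT hε)).exists
  refine lt_of_lt_of_le (pos_iff_ne_zero.2 fun h0 => ?_)
    (measure_mono (s := prePassageGE (startedAt X x) y (y - ε')) ?_)
  · simp [h0] at h1
  · rintro ω ⟨τ, hτ, hle⟩
    exact ⟨τ, hτ, by linarith [h2.2]⟩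

/-- On events before the passage over `b < y`, the `h`-transform is the normalised weight. -/
lemma hTransform_beforePassage [IsProbabilityMeasure P] (hX : IsSubordinator P X)
    (hby : b < y) (hpos : 0 < u (y - x)) (hA : MeasurableSet A) :
    hTransform P (startedAt X x) u x y t (A ∩ beforePassage (startedAt X x) b t) =
      (∫⁻ ω in A ∩ beforePassage (startedAt X x) b t,
        ENNReal.ofReal (u (y - startedAt X x t ω)) ∂P) / ENNReal.ofReal (u (y - x)) := by
  have hΛ0 : NullMeasurableSet (A ∩ beforePassage (startedAt X x) b t) P :=
    hA.nullMeasurableSet.inter (hX.nullMeasurableSet_beforePassage x b t)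
  rw [hTransform, withDensity_apply₀ _ hΛ0, div_eq_mul_inv,
    ← lintegral_mul_const' _ _ (by simpa using hpos)]
  refine lintegral_congr_ae ((ae_restrict_iff'₀ hΛ0).2 (Eventually.of_forall fun ω hω => ?_))
  have hle := le_of_lt_passageTime hω.2
  rw [indicator_of_mem (show ω ∈ {ω | startedAt X x t ω ≤ y} from hle.trans hby.le),
    ENNReal.ofReal_div_of_pos hpos, div_eq_mul_inv]

end IsSubordinator

end Subordinator

theorem mainTheorem2 {Ω : Type*} [MeasurableSpace Ω] (P : Measure Ω) [IsProbabilityMeasure P]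
    (X : ℝ≥0 → Ω → ℝ) (hX : IsSubordinator P X)
    (u : ℝ → ℝ) (hu : IsContinuousPotentialDensity P X u)
    (a x b y : ℝ) (hx : 0 ≤ x) (hxb : x < b) (hby : b < y) (hya : y ≤ a)
    (hpos : 0 < u (y - x)) :
    (∀ ε : ℝ, 0 < ε → 0 < P (prePassageGE (startedAt X x) y (y - ε))) ∧
    ∀ (t : ℝ≥0) (A : Set Ω),
      MeasurableSet[Filtration.natural (startedAt X x) (hX.stronglyMeasurable_startedAt x) t] A →
      Tendsto
        (fun ε : ℝ =>
          (ProbabilityTheory.cond P (prePassageGE (startedAt X x) y (y - ε)))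
            (A ∩ beforePassage (startedAt X x) b t))
        (𝓝[>] 0)
        (𝓝 (hTransform P (startedAt X x) u x y t (A ∩ beforePassage (startedAt X x) b t))) := by
  have hxy : x < y := hxb.trans hby
  refine ⟨fun ε hε => hX.measure_prePassageGE_pos hu hxy hpos hε, fun t A hA => ?_⟩
  have hA' : MeasurableSet A := Filtration.le _ t _ hA
  have hΛ0 : NullMeasurableSet (A ∩ beforePassage (startedAt X x) b t) P :=
    hA'.nullMeasurableSet.inter (hX.nullMeasurableSet_beforePassage x b t)
  rw [hX.hTransform_beforePassage hby hpos hA']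
  refine (ENNReal.Tendsto.div (hX.tendsto_measure_div_passageScale hu hxy hby hpos hA)
    (Or.inr (by simpa using hpos)) (hX.tendsto_measure_prePassageGE_div_passageScale hu hxy hpos)
    (Or.inl ENNReal.ofReal_ne_top)).congr' ?_
  filter_upwards [self_mem_nhdsWithin, hX.eventually_passageScale_ne_top hu hxy hpos] with ε hε hSt
  have hS0 := hX.passageScale_ne_zero hu (sub_pos.2 hxy) hpos hε
  -- Measurability of `A ∩ {t < τ_b⁺}` suffices to evaluate the conditional probability; that of the
  -- conditioning event is not needed.
  rw [ProbabilityTheory.cond, Measure.smul_apply, smul_eq_mul,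
    Measure.restrict_apply₀ (hΛ0.mono_ac Measure.restrict_le_self.absolutelyContinuous)]
  rw [ENNReal.div_eq_inv_mul, ENNReal.div_eq_inv_mul, ENNReal.div_eq_inv_mul,
    ENNReal.mul_inv (Or.inr (measure_ne_top _ _)) (Or.inl (ENNReal.inv_ne_top.2 hS0)), inv_inv]
  rw [mul_mul_mul_comm, ENNReal.mul_inv_cancel hS0 hSt, one_mul]
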